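/- Let $K$ be a field of characteristic $0$, let $F=F(x,y)$ be the free group on $x,y$, and let $\deg:F\to\mathbb Z$ be the total degree, the homomorphism with $\deg(x)=\deg(y)=1$. Fix any linear order on $F$ that is invariant under left and right multiplication and satisfies $a<b$ whenever $\deg(a)<\deg(b)$. Let $\mathcal A(x,y)$ be the Malcev–Neumann algebra of all formal series $\tau=\sum_{a\in F}\alpha_a a$, $\alpha_a\in K$, every nonempty subset of whose support has a largest element, with the convolution product; it contains the free associative algebra $K\langle x,y\rangle$. Let $k\ge 2$ and $$u=(xy)^kx,\quad v=xy,\quad w=yx,\quad g=u^2+v+w,\quad f=u^3+uv+uw+wu .$$ Then: 1. $g$ generates its centralizer in $K\langle x,y\rangle$, i.e. $\{p\in K\langle x,y\rangle: pg=gp\}=K[g]$. 2. The homogeneous component of maximal degree of $g$ is a square in $K\langle x,y\rangle$. 3. There is $\rho\in\mathcal A(x,y)$ with $\rho^2=g$. For every such $\rho$, the coefficient of $u$ in $\rho$ is $1$ or $-1$; the part of $\rho^3$ of positive total degree equals $f$ in the first case and $-f$ in the second. Hence no monomial of positive total degree occurring in $\rho^3$ contains a negative power of $x$ or $y$ (in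 its reduced form). 4. Consequently the following conjecture of Makar-Limanov and Yu fails for $K\langle x,y\rangle$: if $p\in K\langle x,y\rangle$ generates its centralizer and its homogeneous component of maximal degree is an $n$-th power in $K\langle x,y\rangle$, $n\ge1$, then for every $m>n$ not divisible by $n$ and every $\rho\in\mathcal A(x,y)$ with $\rho^n=p$, the series $p^{m/n}=\rho^m$ has a monomial of positive total degree containing a negative power of a generator. -/

import Mathlib

noncomputable section

open Function

/-! ### Malcev--Neumann series over a linearly ordered group -/

/-- `S` is well ordered for the opposite order: each nonempty subset of `S` has a largest
element. -/
def IsReverseWellOrdered {G : Type*} [LinearOrder G] (S : Set G) : Prop :=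
  ∀ T : Set G, T ⊆ S → T.Nonempty → ∃ a, IsGreatest T a

namespace IsReverseWellOrdered

theorem mono {G : Type*} [LinearOrder G] {S T : Set G} (hT : IsReverseWellOrdered T)
    (h : S ⊆ T) : IsReverseWellOrdered S :=
  fun U hU hne => hT U (hU.trans h) hne

theorem of_finite {G : Type*} [LinearOrder G] {S : Set G} (hS : S.Finite) :
    IsReverseWellOrdered S := by
  intro T hT hne
  obtain ⟨a, ha, h⟩ := Set.exists_max_image T id (hS.subset hT) hne
  exact ⟨a, ha, h⟩

theorem union {G : Type*} [LinearOrder G] {S T : Set G} (hS : IsReverseWellOrdered S)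
    (hT : IsReverseWellOrdered T) : IsReverseWellOrdered (S ∪ T) := by
  intro U hU hne
  by_cases h1 : (U ∩ S).Nonempty
  · obtain ⟨a, ha, ha'⟩ := hS _ Set.inter_subset_right h1
    by_cases h2 : (U ∩ T).Nonempty
    · obtain ⟨b, hb, hb'⟩ := hT _ Set.inter_subset_right h2
      refine ⟨max a b, ?_, ?_⟩
      · rcases max_choice a b with h | h <;> rw [h]
        · exact ha.1
        · exact hb.1
      · intro c hc
        rcases hU hc with h | h
        · exact le_max_of_le_left (ha' ⟨hc, h⟩)
        · exact le_max_of_le_right (hb' ⟨hc, h⟩)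
    · refine ⟨a, ha.1, fun c hc => ?_⟩
      rcases hU hc with h | h
      · exact ha' ⟨hc, h⟩
      · exact absurd ⟨c, hc, h⟩ h2
  · refine hT U (fun c hc => ?_) hne
    rcases hU hc with h | h
    · exact absurd ⟨c, hc, h⟩ h1
    · exact h

theorem isPWO {G : Type*} [LinearOrder G] {S : Set G} (hS : IsReverseWellOrdered S) :
    (OrderDual.ofDual ⁻¹' S).IsPWO := by
  rw [Set.isPWO_iff_isWF, Set.isWF_iff_no_descending_seq]
  intro f hf hmem
  obtain ⟨a, ⟨n, rfl⟩, ha⟩ := hS (Set.range fun n => OrderDual.ofDual (f n))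
    (by rintro _ ⟨n, rfl⟩; exact hmem n) (Set.range_nonempty _)
  exact absurd (ha ⟨n + 1, rfl⟩) (not_le_of_gt (hf (Nat.lt_succ_self n)))

theorem of_isPWO {G : Type*} [LinearOrder G] {S : Set G}
    (hS : (OrderDual.ofDual ⁻¹' S).IsPWO) : IsReverseWellOrdered S := by
  intro T hT hne
  have hwf : (OrderDual.ofDual ⁻¹' T).IsWF := (hS.mono (Set.preimage_mono hT)).isWF
  have hne' : (OrderDual.ofDual ⁻¹' T).Nonempty := hne
  exact ⟨OrderDual.ofDual (hwf.min hne'), hwf.min_mem hne',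
    fun c hc => hwf.min_le hne' (a := OrderDual.toDual c) hc⟩

open scoped Pointwise in
theorem mul {G : Type*} [Group G] [LinearOrder G] [MulLeftMono G] [MulRightMono G]
    {S T : Set G} (hS : IsReverseWellOrdered S) (hT : IsReverseWellOrdered T) :
    IsReverseWellOrdered (S * T) := by
  apply of_isPWO
  have := (hS.isPWO.prod hT.isPWO).image_of_monotone
    (f := fun p : Gᵒᵈ × Gᵒᵈ =>
      OrderDual.toDual (OrderDual.ofDual p.1 * OrderDual.ofDual p.2))
    (fun p q h => mul_le_mul' (α := G) h.1 h.2)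
  refine this.mono ?_
  rintro c ⟨a, ha, b, hb, h⟩
  exact ⟨(OrderDual.toDual a, OrderDual.toDual b), ⟨ha, hb⟩, h⟩

theorem finite_antidiagonal {G : Type*} [Group G] [LinearOrder G] [MulLeftMono G]
    [MulRightMono G] {S T : Set G} (hS : IsReverseWellOrdered S)
    (hT : IsReverseWellOrdered T) (w : G) : {a : G | a ∈ S ∧ a⁻¹ * w ∈ T}.Finite := by
  by_contra hinf
  have hinf : {a : G | a ∈ S ∧ a⁻¹ * w ∈ T}.Infinite := hinf
  let f := hinf.natEmbedding
  obtain ⟨g, hg⟩ := hS.isPWO.exists_monotone_subseq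
    (f := fun n => OrderDual.toDual (f n : G)) (fun n => (f n).2.1)
  obtain ⟨g', hg'⟩ := hT.isPWO.exists_monotone_subseq
    (f := fun n => OrderDual.toDual ((f (g n) : G)⁻¹ * w)) (fun n => (f (g n)).2.2)
  have hlt : g' 0 < g' 1 := g'.strictMono Nat.zero_lt_one
  have h1 : (f (g (g' 1)) : G) ≤ f (g (g' 0)) := hg hlt.le
  have h2 : (f (g (g' 1)) : G)⁻¹ * w ≤ (f (g (g' 0)) : G)⁻¹ * w := hg' (Nat.zero_le 1)
  have h3 : (f (g (g' 0)) : G) ≤ f (g (g' 1)) := by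
    have h4 := mul_le_mul_left (mul_le_mul_right h2 (f (g (g' 1)) : G)) (w⁻¹ * f (g (g' 0)))
    simpa [mul_assoc] using h4
  exact hlt.ne (g.injective (f.injective (Subtype.ext (le_antisymm h3 h1))))

end IsReverseWellOrdered

/-- Formal series `∑ α_w w` with `w ∈ G` and `α_w ∈ K` whose support is well ordered for the
opposite of the order of `G`. -/
@[ext]
structure MalcevNeumann (K G : Type*) [Zero K] [LinearOrder G] where
  coeff : G → K
  support_wo : IsReverseWellOrdered (support coeff)

namespace MalcevNeumann

section Additive

variable {K G : Type*} [Field K] [LinearOrder G]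

theorem coeff_injective : Injective (coeff : MalcevNeumann K G → G → K) :=
  fun _ _ h => MalcevNeumann.ext h

instance : Zero (MalcevNeumann K G) := ⟨⟨0, .of_finite (by simp)⟩⟩

instance : Add (MalcevNeumann K G) :=
  ⟨fun σ τ => ⟨σ.coeff + τ.coeff, (σ.support_wo.union τ.support_wo).mono (support_add _ _)⟩⟩

instance : Neg (MalcevNeumann K G) :=
  ⟨fun σ => ⟨-σ.coeff, σ.support_wo.mono (support_neg _).subset⟩⟩

instance : Sub (MalcevNeumann K G) :=
  ⟨fun σ τ => ⟨σ.coeff - τ.coeff, (σ.support_wo.union τ.support_wo).mono (support_sub _ _)⟩⟩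

instance {R : Type*} [SMulZeroClass R K] : SMul R (MalcevNeumann K G) :=
  ⟨fun r σ => ⟨r • σ.coeff, σ.support_wo.mono (support_const_smul_subset r σ.coeff)⟩⟩

instance : AddCommGroup (MalcevNeumann K G) :=
  coeff_injective.addCommGroup coeff rfl (fun _ _ => rfl) (fun _ => rfl) (fun _ _ => rfl)
    (fun _ _ => rfl) (fun _ _ => rfl)

instance : Module K (MalcevNeumann K G) :=
  coeff_injective.module K ⟨⟨coeff, rfl⟩, fun _ _ => rfl⟩ (fun _ _ => rfl)

theorem coeff_zero (w : G) : (0 : MalcevNeumann K G).coeff w = 0 := rfl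

theorem coeff_add (σ τ : MalcevNeumann K G) (w : G) :
    (σ + τ).coeff w = σ.coeff w + τ.coeff w := rfl

theorem coeff_neg (σ : MalcevNeumann K G) (w : G) : (-σ).coeff w = -σ.coeff w := rfl

theorem coeff_sub (σ τ : MalcevNeumann K G) (w : G) :
    (σ - τ).coeff w = σ.coeff w - τ.coeff w := rfl

theorem coeff_smul (c : K) (σ : MalcevNeumann K G) (w : G) :
    (c • σ).coeff w = c * σ.coeff w := rfl

/-- The series consisting of the single term `c w`. -/
def single (w : G) (c : K) : MalcevNeumann K G :=
  ⟨fun v => open Classical in if v = w then c else 0,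
    .of_finite ((Set.finite_singleton w).subset fun v hv => by
      by_contra h
      exact hv (if_neg h))⟩

theorem coeff_single (w : G) (c : K) (v : G) [Decidable (v = w)] :
    (single w c).coeff v = if v = w then c else 0 := by
  simp only [single]
  congr

end Additive

section Multiplicative

open scoped Pointwise in
theorem support_convolution_subset {K G : Type*} [Field K] [Group G]
    [LinearOrder G] (σ τ : MalcevNeumann K G) :
    (support fun w => ∑ᶠ a : G, σ.coeff a * τ.coeff (a⁻¹ * w)) ⊆
      support σ.coeff * support τ.coeff := by
  intro w hw
  obtain ⟨a, ha⟩ : ∃ a : G, σ.coeff a * τ.coeff (a⁻¹ * w) ≠ 0 := by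
    by_contra! h
    exact hw (by simp [h])
  exact ⟨a, left_ne_zero_of_mul ha, a⁻¹ * w, right_ne_zero_of_mul ha, mul_inv_cancel_left a w⟩

variable {K G : Type*} [Field K] [Group G] [LinearOrder G] [MulLeftMono G] [MulRightMono G]

theorem finite_convolution (σ τ : MalcevNeumann K G) (w : G) :
    (support fun a => σ.coeff a * τ.coeff (a⁻¹ * w)).Finite :=
  (σ.support_wo.finite_antidiagonal τ.support_wo w).subset
    fun _ ha => ⟨left_ne_zero_of_mul ha, right_ne_zero_of_mul ha⟩

/-- The product of series: the coefficient of `w` is the sum of `σ_a τ_b` over all `a b = w`.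
By `finite_convolution` only finitely many terms of that sum are nonzero. -/
instance : Mul (MalcevNeumann K G) :=
  ⟨fun σ τ => ⟨fun w => ∑ᶠ a : G, σ.coeff a * τ.coeff (a⁻¹ * w),
    (σ.support_wo.mul τ.support_wo).mono (support_convolution_subset σ τ)⟩⟩

instance : One (MalcevNeumann K G) := ⟨single 1 1⟩

theorem coeff_mul (σ τ : MalcevNeumann K G) (w : G) :
    (σ * τ).coeff w = ∑ᶠ a : G, σ.coeff a * τ.coeff (a⁻¹ * w) := rfl

theorem coeff_single_mul (v : G) (c : K) (σ : MalcevNeumann K G) (w : G) :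
    (single v c * σ).coeff w = c * σ.coeff (v⁻¹ * w) := by
  classical
  rw [coeff_mul, finsum_eq_single _ v]
  · simp [coeff_single]
  · intro a ha
    simp [coeff_single, ha]

theorem coeff_mul_single (v : G) (c : K) (σ : MalcevNeumann K G) (w : G) :
    (σ * single v c).coeff w = σ.coeff (w * v⁻¹) * c := by
  classical
  rw [coeff_mul, finsum_eq_single _ (w * v⁻¹)]
  · simp [coeff_single]
  · intro a ha
    have h : a⁻¹ * w ≠ v := fun h => ha (by rw [← h]; group)
    simp [coeff_single, h]

theorem mul_assoc_aux (σ τ ρ : MalcevNeumann K G) : σ * τ * ρ = σ * (τ * ρ) := by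
  ext w
  have hA := σ.support_wo.finite_antidiagonal (τ.support_wo.mul ρ.support_wo) w
  have hB := (σ.support_wo.mul τ.support_wo).finite_antidiagonal ρ.support_wo w
  have left : (σ * τ * ρ).coeff w = ∑ b ∈ hB.toFinset, ∑ a ∈ hA.toFinset,
      σ.coeff a * τ.coeff (a⁻¹ * b) * ρ.coeff (b⁻¹ * w) := by
    rw [coeff_mul, finsum_eq_sum_of_support_subset (s := hB.toFinset)]
    · refine Finset.sum_congr rfl fun b hb => ?_
      rw [coeff_mul, finsum_eq_sum_of_support_subset (s := hA.toFinset), Finset.sum_mul]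
      intro a ha
      rw [hB.mem_toFinset] at hb
      rw [hA.coe_toFinset]
      exact ⟨left_ne_zero_of_mul ha, a⁻¹ * b, right_ne_zero_of_mul ha, b⁻¹ * w, hb.2,
        by simp [mul_assoc]⟩
    · intro b hb
      rw [hB.coe_toFinset]
      exact ⟨support_convolution_subset σ τ (left_ne_zero_of_mul hb),
        right_ne_zero_of_mul hb⟩
  have right : (σ * (τ * ρ)).coeff w = ∑ a ∈ hA.toFinset, ∑ b ∈ hB.toFinset,
      σ.coeff a * τ.coeff (a⁻¹ * b) * ρ.coeff (b⁻¹ * w) := by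
    rw [coeff_mul, finsum_eq_sum_of_support_subset (s := hA.toFinset)]
    · refine Finset.sum_congr rfl fun a ha => ?_
      rw [hA.mem_toFinset] at ha
      have h : (τ * ρ).coeff (a⁻¹ * w) =
          ∑ᶠ b : G, τ.coeff (a⁻¹ * b) * ρ.coeff (b⁻¹ * w) := by
        rw [coeff_mul, ← finsum_comp_equiv (Equiv.mulLeft a⁻¹)]
        simp [mul_assoc]
      rw [h, finsum_eq_sum_of_support_subset (s := hB.toFinset), Finset.mul_sum]
      · simp only [mul_assoc]
      · intro b hb
        rw [hB.coe_toFinset]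
        exact ⟨⟨a, ha.1, a⁻¹ * b, left_ne_zero_of_mul hb, mul_inv_cancel_left a b⟩,
          right_ne_zero_of_mul hb⟩
    · intro a ha
      rw [hA.coe_toFinset]
      exact ⟨left_ne_zero_of_mul ha, support_convolution_subset τ ρ (right_ne_zero_of_mul ha)⟩
  rw [left, right, Finset.sum_comm]

instance : Ring (MalcevNeumann K G) where
  __ := (inferInstance : AddCommGroup (MalcevNeumann K G))
  one_mul σ := by
    ext w
    exact (coeff_single_mul 1 1 σ w).trans (by simp)
  mul_one σ := by
    ext w
    exact (coeff_mul_single 1 1 σ w).trans (by simp)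
  mul_assoc := mul_assoc_aux
  zero_mul σ := by
    ext w
    simp [coeff_mul, coeff_zero]
  mul_zero σ := by
    ext w
    simp [coeff_mul, coeff_zero]
  left_distrib σ τ ρ := by
    ext w
    simp only [coeff_mul, coeff_add, mul_add]
    exact finsum_add_distrib (finite_convolution σ τ w) (finite_convolution σ ρ w)
  right_distrib σ τ ρ := by
    ext w
    simp only [coeff_mul, coeff_add, add_mul]
    exact finsum_add_distrib (finite_convolution σ ρ w) (finite_convolution τ ρ w)

instance : Algebra K (MalcevNeumann K G) :=
  Algebra.ofModule
    (fun c σ τ => by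
      ext w
      simp only [coeff_mul, coeff_smul, mul_assoc]
      exact (mul_finsum _ c).symm)
    (fun c σ τ => by
      ext w
      simp only [coeff_mul, coeff_smul, mul_left_comm]
      exact (mul_finsum _ c).symm)

end Multiplicative

end MalcevNeumann

/-! ### The free group -/

/-- The total degree on the free group, with `deg (x_i ^ (±1)) = ±1`. -/
def totalDegree {X : Type*} (w : FreeGroup X) : ℤ :=
  (FreeGroup.lift (fun _ : X => Multiplicative.ofAdd (1 : ℤ)) w).toAdd

/-- The reduced word of `w` contains a negative power of some generator. -/
def HasNegativePower {X : Type*} [DecidableEq X] (w : FreeGroup X) : Prop :=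
  ∃ i : X, (i, false) ∈ w.toWord

namespace MalcevNeumann

/-- The part of positive total degree of a series over the free group. -/
def positivePart {K X : Type*} [Field K] [LinearOrder (FreeGroup X)]
    (σ : MalcevNeumann K (FreeGroup X)) : MalcevNeumann K (FreeGroup X) :=
  ⟨fun w => if 0 < totalDegree w then σ.coeff w else 0,
    σ.support_wo.mono fun w hw => by
      by_contra h
      simp_all⟩

/-- Some monomial of positive total degree occurring in `σ` contains a negative power of a
generator. -/
def HasPositiveMonomialWithNegativePower {K X : Type*} [Field K] [DecidableEq X]
    [LinearOrder (FreeGroup X)] (σ : MalcevNeumann K (FreeGroup X)) : Prop :=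
  ∃ w : FreeGroup X, σ.coeff w ≠ 0 ∧ 0 < totalDegree w ∧ HasNegativePower w

/-- The embedding `K⟨X⟩ → 𝒜(X)` sending each variable to the corresponding generator. -/
def ofFreeAlgebra (K X : Type*) [Field K] [LinearOrder (FreeGroup X)]
    [MulLeftMono (FreeGroup X)] [MulRightMono (FreeGroup X)] :
    FreeAlgebra K X →ₐ[K] MalcevNeumann K (FreeGroup X) :=
  FreeAlgebra.lift K fun i => single (FreeGroup.of i) 1

end MalcevNeumann

/-! ### The free associative algebra -/

namespace FreeAlgebra

variable {K X : Type*} [Field K]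

/-- The coefficients of a noncommutative polynomial, indexed by the words in the variables. -/
def wordCoeff (p : FreeAlgebra K X) : FreeMonoid X →₀ K :=
  (equivMonoidAlgebraFreeMonoid (R := K) (X := X) p).coeff

/-- The total degree of a noncommutative polynomial (`0` for the zero polynomial). -/
def deg (p : FreeAlgebra K X) : ℕ := p.wordCoeff.support.sup FreeMonoid.length

/-- The homogeneous component of maximal degree. -/
def leadingComponent (p : FreeAlgebra K X) : FreeAlgebra K X :=
  (equivMonoidAlgebraFreeMonoid (R := K) (X := X)).symm
    (MonoidAlgebra.ofCoeff (p.wordCoeff.filter fun w => w.length = p.deg))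

/-- `p` generates its centralizer: `C(p) = K[p]`. -/
def GeneratesCentralizer (p : FreeAlgebra K X) : Prop :=
  Subalgebra.centralizer K {p} = Algebra.adjoin K {p}

end FreeAlgebra

/-- The Makar-Limanov--Yu conjecture over `K⟨X⟩`, for the Malcev--Neumann algebra `𝒜(X)` of the
given order on the free group: if `g` generates its centralizer and its homogeneous component of
maximal degree is an `n`-th power, then for every `m > n` not divisible by `n` the series
`g ^ (m / n) = ρ ^ m`, where `ρ ^ n = g`, has a monomial of positive degree containing a negative
power of a generator. -/
def MakarLimanovYuConjecture (K X : Type*) [Field K] [DecidableEq X]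
    [LinearOrder (FreeGroup X)] [MulLeftMono (FreeGroup X)] [MulRightMono (FreeGroup X)] : Prop :=
  ∀ (g : FreeAlgebra K X) (n : ℕ), 0 < n → g.GeneratesCentralizer →
    (∃ h : FreeAlgebra K X, g.leadingComponent = h ^ n) →
    ∀ m : ℕ, n < m → ¬ n ∣ m →
      ∀ ρ : MalcevNeumann K (FreeGroup X), ρ ^ n = MalcevNeumann.ofFreeAlgebra K X g →
        (ρ ^ m).HasPositiveMonomialWithNegativePower

end

/-!
Write `u = (x y) ^ k x`, `v = x y`, `w = y x` and `d = 2 k + 1` for the degree of `u`. Everything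
rests on the identity `v u = u w`: the element `c = u⁻¹ v = w u⁻¹` of the free group satisfies
`u c = v` and `c u = w`, so that `g = u ^ 2 + v + w = (u + c) ^ 2 - c ^ 2`.

*The square root.* In an ordered group a series with leading term `u ^ 2` has a square root
(`MalcevNeumann.exists_sq_eq`). Its terms are found in decreasing order: the leading term of
`uσ + σu` sits at `max (u b) (b u)`, `b` being the leading monomial of `σ`, so the leading term of
the residual `g - σ ^ 2` can always be cancelled by one smaller term, and Zorn's lemma carries this
past limit stages. For a square root `ρ` of `g` with leading term `u` the same remark shows
`ρ = u + c + ε` with `ε` of degree at most `4 - 3 d`. Therefore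
`ρ ^ 3 = g ρ = u ^ 3 + u v + u w + w u + (v + w) (c + ε) + u ^ 2 ε`, where the last two summands
have degree at most `4 - d < 0` (`MalcevNeumann.coeff_cube_of_sq_eq`).

*The centralizer.* Let `p` commute with `g`. The top component of `p` commutes with `u ^ 2`. The
support of an element commuting with a monomial `t` is stable under conjugation by `t`, and, being
reverse well ordered, it consists of elements commuting with `t`; as `u` is not a proper power, the
top component of `p` is `α u ^ j`. If `j` is even, one subtracts `α g ^ (j / 2)` and proceeds by
induction on the degree. If `j` is odd, one may take it large, replacing `p` by `p g ^ 2`. The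
component `p₁` of `p` lying `2 d - 2` degrees below the top then solves
`p₁ u ^ 2 - u ^ 2 p₁ = α ((v + w) u ^ j - u ^ j (v + w))`, which determines it up to elements
commuting with `u`. But there is a representation by `2 × 2` matrices with `u ^ 2 ↦ 1` in which
`v + w` and `u` have proportional images. There `p g = g p` forces all components of `p` in question
to commute with `u`, and the solutions of the above equation do not unless `α = 0`
(`FreeAlgebra.eq_zero_of_hasTop_odd`).
-/

noncomputable section

open Function

/-! ### Leading terms of series -/

namespace MalcevNeumann

variable {K G : Type*} [Field K]

section Order

variable [LinearOrder G]

theorem coeff_single_self (a : G) (c : K) : (single a c).coeff a = c := by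
  classical
  simp [coeff_single]

theorem coeff_single_of_ne {a b : G} (c : K) (h : b ≠ a) : (single a c).coeff b = 0 := by
  classical
  simp [coeff_single, h]

theorem eq_of_coeff_single_ne_zero {a b : G} {c : K} (h : (single a c).coeff b ≠ 0) : b = a := by
  by_contra hb
  exact h (coeff_single_of_ne c hb)

theorem exists_leading {σ : MalcevNeumann K G} (hσ : σ ≠ 0) :
    ∃ b, σ.coeff b ≠ 0 ∧ ∀ a, σ.coeff a ≠ 0 → a ≤ b := by
  have hne : (support σ.coeff).Nonempty := by
    by_contra h
    rw [Set.not_nonempty_iff_eq_empty, support_eq_empty_iff] at h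
    exact hσ (coeff_injective h)
  obtain ⟨b, hb, hb'⟩ := σ.support_wo _ subset_rfl hne
  exact ⟨b, hb, fun a ha => hb' ha⟩

theorem coeff_add_ne_zero {σ τ : MalcevNeumann K G} {a : G} (h : (σ + τ).coeff a ≠ 0) :
    σ.coeff a ≠ 0 ∨ τ.coeff a ≠ 0 := by
  by_contra! h'
  exact h (by rw [coeff_add, h'.1, h'.2, add_zero])

theorem coeff_sub_ne_zero {σ τ : MalcevNeumann K G} {a : G} (h : (σ - τ).coeff a ≠ 0) :
    σ.coeff a ≠ 0 ∨ τ.coeff a ≠ 0 := by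
  by_contra! h'
  exact h (by rw [coeff_sub, h'.1, h'.2, sub_zero])

theorem coeff_neg_ne_zero {σ : MalcevNeumann K G} {a : G} (h : (-σ).coeff a ≠ 0) :
    σ.coeff a ≠ 0 := fun h' => h (by rw [coeff_neg, h', neg_zero])

/-- `τ` continues `σ` by monomials smaller than those of `σ`. -/
def IsEndExtension (σ τ : MalcevNeumann K G) : Prop :=
  (∀ a, σ.coeff a ≠ 0 → τ.coeff a = σ.coeff a) ∧
    ∀ a b, σ.coeff a ≠ 0 → σ.coeff b = 0 → τ.coeff b ≠ 0 → b < a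

theorem IsEndExtension.refl (σ : MalcevNeumann K G) : IsEndExtension σ σ :=
  ⟨fun _ _ => rfl, fun _ _ _ h h' => absurd h h'⟩

theorem IsEndExtension.trans {σ τ ρ : MalcevNeumann K G} (h : IsEndExtension σ τ)
    (h' : IsEndExtension τ ρ) : IsEndExtension σ ρ := by
  refine ⟨fun a ha => ?_, fun a b ha hb hb' => ?_⟩
  · rw [h'.1 a (by rwa [h.1 a ha]), h.1 a ha]
  · by_cases hτ : τ.coeff b = 0
    · exact h'.2 a b (by rwa [h.1 a ha]) hτ hb'
    · exact h.2 a b ha hb hτ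

theorem IsEndExtension.antisymm {σ τ : MalcevNeumann K G} (h : IsEndExtension σ τ)
    (h' : IsEndExtension τ σ) : σ = τ := by
  ext a
  by_cases ha : σ.coeff a = 0
  · by_cases hb : τ.coeff a = 0
    · rw [ha, hb]
    · exact h'.1 a hb
  · exact (h.1 a ha).symm

/-- A chain of end extensions has a union. -/
theorem exists_union_of_chain {c : Set (MalcevNeumann K G)} (hc : IsChain IsEndExtension c) :
    ∃ τ : MalcevNeumann K G, (∀ σ ∈ c, IsEndExtension σ τ) ∧
      ∀ a, τ.coeff a ≠ 0 → ∃ σ ∈ c, σ.coeff a ≠ 0 := by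
  classical
  have hcomp : ∀ σ ∈ c, ∀ τ ∈ c, IsEndExtension σ τ ∨ IsEndExtension τ σ := by
    intro σ hσ τ hτ
    by_cases h : σ = τ
    · exact Or.inl (h ▸ .refl σ)
    · exact hc hσ hτ h
  let F : G → K := fun a => if h : ∃ σ ∈ c, σ.coeff a ≠ 0 then h.choose.coeff a else 0
  have hF : ∀ σ ∈ c, ∀ a, σ.coeff a ≠ 0 → F a = σ.coeff a := by
    intro σ hσ a ha
    have h : ∃ σ ∈ c, σ.coeff a ≠ 0 := ⟨σ, hσ, ha⟩
    have hF' : F a = h.choose.coeff a := dif_pos h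
    rw [hF']
    rcases hcomp _ h.choose_spec.1 σ hσ with h' | h'
    · exact (h'.1 a h.choose_spec.2).symm
    · exact h'.1 a ha
  have hF0 : ∀ a, F a ≠ 0 → ∃ σ ∈ c, σ.coeff a ≠ 0 := by
    intro a ha
    by_contra h
    exact ha (dif_neg h)
  have hlt : ∀ σ ∈ c, ∀ a b, σ.coeff a ≠ 0 → σ.coeff b = 0 → F b ≠ 0 → b < a := by
    intro σ hσ a b ha hb hb'
    obtain ⟨τ, hτ, hτb⟩ := hF0 b hb'
    rcases hcomp σ hσ τ hτ with h | h
    · exact h.2 a b ha hb hτb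
    · exact absurd ((h.1 b hτb).symm.trans hb) hτb
  refine ⟨⟨F, fun T hT hne => ?_⟩, fun σ hσ => ⟨hF σ hσ, hlt σ hσ⟩, hF0⟩
  obtain ⟨b, hb⟩ := hne
  obtain ⟨σ, hσ, hσb⟩ := hF0 b (hT hb)
  obtain ⟨m, hm, hm'⟩ := σ.support_wo (T ∩ support σ.coeff) Set.inter_subset_right ⟨b, hb, hσb⟩
  refine ⟨m, hm.1, fun a ha => ?_⟩
  by_cases h : σ.coeff a = 0
  · exact (hlt σ hσ m a hm.2 h (hT ha)).le
  · exact hm' ⟨ha, h⟩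

end Order

variable [Group G] [LinearOrder G] [MulLeftMono G] [MulRightMono G]

theorem exists_of_coeff_mul_ne_zero {σ τ : MalcevNeumann K G} {w : G}
    (h : (σ * τ).coeff w ≠ 0) : ∃ a b, σ.coeff a ≠ 0 ∧ τ.coeff b ≠ 0 ∧ a * b = w := by
  obtain ⟨a, ha, b, hb, hab⟩ := support_convolution_subset σ τ h
  exact ⟨a, b, ha, hb, hab⟩

/-- Leading coefficients multiply. -/
theorem coeff_mul_of_le {σ τ : MalcevNeumann K G} {b c : G} (hσ : ∀ a, σ.coeff a ≠ 0 → a ≤ b)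
    (hτ : ∀ a, τ.coeff a ≠ 0 → a ≤ c) : (σ * τ).coeff (b * c) = σ.coeff b * τ.coeff c := by
  rw [coeff_mul, finsum_eq_single _ b]
  · simp
  · intro a ha
    by_contra h
    have h1 := lt_of_le_of_ne (hσ a (left_ne_zero_of_mul h)) ha
    have h2 := hτ _ (right_ne_zero_of_mul h)
    have h3 : b * c ≤ a * c := by simpa [mul_assoc] using mul_le_mul_right h2 a
    exact absurd (lt_of_le_of_lt h3 (mul_lt_mul_left h1 c)) (lt_irrefl _)

variable (K) in
/-- The group elements as series with a single term of coefficient `1`. -/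
def monomial : G →* MalcevNeumann K G where
  toFun a := single a 1
  map_one' := rfl
  map_mul' a b := by
    classical
    ext w
    rw [coeff_single_mul, coeff_single, coeff_single, one_mul]
    simp only [inv_mul_eq_iff_eq_mul]

theorem coeff_monomial_self (a : G) : (monomial K a).coeff a = 1 := coeff_single_self a 1

theorem eq_of_coeff_monomial_ne_zero {a b : G} (h : (monomial K a).coeff b ≠ 0) : b = a :=
  eq_of_coeff_single_ne_zero h

theorem coeff_monomial_mul (a : G) (σ : MalcevNeumann K G) (w : G) :
    (monomial K a * σ).coeff w = σ.coeff (a⁻¹ * w) :=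
  (coeff_single_mul a 1 σ w).trans (one_mul _)

theorem coeff_mul_monomial (a : G) (σ : MalcevNeumann K G) (w : G) :
    (σ * monomial K a).coeff w = σ.coeff (w * a⁻¹) :=
  (coeff_mul_single a 1 σ w).trans (mul_one _)

/-- If `b` is the leading monomial of `σ`, then `max (u * b) (b * u)` is that of `uσ + σu`: the
two candidates cannot cancel, since in characteristic other than `2` even their coincidence gives
the coefficient `2σ_b`. -/
theorem coeff_anticommutator_ne_zero (h2 : (2 : K) ≠ 0) (u : G) {σ : MalcevNeumann K G} {b : G}
    (hb : σ.coeff b ≠ 0) (hσ : ∀ a, σ.coeff a ≠ 0 → a ≤ b) :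
    (monomial K u * σ + σ * monomial K u).coeff (max (u * b) (b * u)) ≠ 0 := by
  rw [coeff_add, coeff_monomial_mul, coeff_mul_monomial]
  rcases lt_trichotomy (u * b) (b * u) with h | h | h
  · have h0 : σ.coeff (u⁻¹ * (b * u)) = 0 := by
      by_contra h'
      have := mul_le_mul_right (hσ _ h') u
      rw [mul_inv_cancel_left] at this
      exact absurd h (not_lt_of_ge this)
    rw [max_eq_right h.le, h0, zero_add, mul_inv_cancel_right]
    exact hb
  · rw [h, max_self, ← h, inv_mul_cancel_left, h, mul_inv_cancel_right, ← two_mul]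
    exact mul_ne_zero h2 hb
  · have h0 : σ.coeff (u * b * u⁻¹) = 0 := by
      by_contra h'
      have := mul_le_mul_left (hσ _ h') u
      rw [inv_mul_cancel_right] at this
      exact absurd h (not_lt_of_ge this)
    rw [max_eq_left h.le, h0, add_zero, inv_mul_cancel_left]
    exact hb

/-! ### Square roots -/

/-- `σ` is an initial segment of a square root of `g` with leading monomial `u`: each monomial of
`g - σ ^ 2` is smaller than the monomials `max (u * a) (a * u)` which the terms `a` of `σ` have
served to cancel. -/
def IsPartialSqrt (g : MalcevNeumann K G) (u : G) (σ : MalcevNeumann K G) : Prop :=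
  σ.coeff u = 1 ∧ (∀ a, σ.coeff a ≠ 0 → a ≤ u) ∧
    ∀ a b, σ.coeff a ≠ 0 → (g - σ ^ 2).coeff b ≠ 0 → b < max (u * a) (a * u)

theorem lt_max_mul_mul {u a b c : G} (h : a < c) (hb : b ≤ max (u * a) (a * u)) :
    b < max (u * c) (c * u) :=
  hb.trans_lt (max_lt_max (mul_lt_mul_right h u) (mul_lt_mul_left h u))

/-- Adding to `σ`, whose monomials are at most `u`, a series `δ` changes `σ ^ 2` only by monomials
that are at most `max (u * d) (d * u)` for some monomial `d` of `δ`. -/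
theorem exists_le_of_coeff_sq_sub {u : G} {σ δ : MalcevNeumann K G}
    (hσ : ∀ a, σ.coeff a ≠ 0 → a ≤ u) (hδ : ∀ a, δ.coeff a ≠ 0 → a ≤ u) {b : G}
    (hb : ((σ + δ) ^ 2 - σ ^ 2).coeff b ≠ 0) :
    ∃ d, δ.coeff d ≠ 0 ∧ b ≤ max (u * d) (d * u) := by
  have h : (σ + δ) ^ 2 - σ ^ 2 = σ * δ + δ * σ + δ * δ := by noncomm_ring
  rw [h] at hb
  rcases coeff_add_ne_zero hb with hb | hb
  · rcases coeff_add_ne_zero hb with hb | hb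
    · obtain ⟨a, d, ha, hd, rfl⟩ := exists_of_coeff_mul_ne_zero hb
      exact ⟨d, hd, le_max_of_le_left (mul_le_mul_left (hσ a ha) d)⟩
    · obtain ⟨d, a, hd, ha, rfl⟩ := exists_of_coeff_mul_ne_zero hb
      exact ⟨d, hd, le_max_of_le_right (mul_le_mul_right (hσ a ha) d)⟩
  · obtain ⟨a, d, ha, hd, rfl⟩ := exists_of_coeff_mul_ne_zero hb
    exact ⟨d, hd, le_max_of_le_left (mul_le_mul_left (hδ a ha) d)⟩

/-- A partial square root which is not a square root has a proper end extension. -/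
theorem IsPartialSqrt.exists_extension (h2 : (2 : K) ≠ 0) {g σ : MalcevNeumann K G} {u : G}
    (hσ : IsPartialSqrt g u σ) (hne : σ ^ 2 ≠ g) :
    ∃ τ, IsPartialSqrt g u τ ∧ IsEndExtension σ τ ∧ τ ≠ σ := by
  obtain ⟨h1, hle, hres⟩ := hσ
  obtain ⟨b, hb, hbmax⟩ := exists_leading (sub_ne_zero.2 hne.symm)
  -- The term `c t` is the unique one for which the leading terms of `u t + t u` and of
  -- `g - σ ^ 2` have the same monomial `b`.
  obtain ⟨t, ht, htb⟩ : ∃ t, max (u * t) (t * u) = b ∧ ∀ a, b < max (u * a) (a * u) → t < a := by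
    refine ⟨min (u⁻¹ * b) (b * u⁻¹), ?_, fun a ha => ?_⟩
    · rcases le_total (u⁻¹ * b) (b * u⁻¹) with h | h
      · rw [min_eq_left h, mul_inv_cancel_left, max_eq_left]
        simpa using mul_le_mul_left h u
      · rw [min_eq_right h, inv_mul_cancel_right, max_eq_right]
        simpa using mul_le_mul_right h u
    · rcases lt_max_iff.1 ha with h | h
      · exact min_lt_of_left_lt (by simpa using mul_lt_mul_right h u⁻¹)
      · exact min_lt_of_right_lt (by simpa using mul_lt_mul_left h u⁻¹)
  have htσ : ∀ a, σ.coeff a ≠ 0 → t < a := fun a ha => htb a (hres a b ha hb)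
  have htu : t < u := htσ u (by rw [h1]; exact one_ne_zero)
  obtain ⟨e, he0, he⟩ : ∃ e : K, e ≠ 0 ∧
      (monomial K u * single t 1 + single t 1 * monomial K u).coeff b = e := ⟨_, by
    rw [← ht]
    exact coeff_anticommutator_ne_zero h2 u (by rw [coeff_single_self]; exact one_ne_zero)
      fun a ha => (eq_of_coeff_single_ne_zero ha).le, rfl⟩
  obtain ⟨c, hc0, hc⟩ : ∃ c : K, c ≠ 0 ∧ c * e = (g - σ ^ 2).coeff b :=
    ⟨(g - σ ^ 2).coeff b / e, div_ne_zero hb he0, div_mul_cancel₀ _ he0⟩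
  have hσt : σ.coeff t = 0 := by
    by_contra h
    exact lt_irrefl t (htσ t h)
  have hsingle : single t c = c • (single t 1 : MalcevNeumann K G) := by
    classical
    ext w
    rw [coeff_smul, coeff_single, coeff_single]
    simp
  have hδu : ∀ a, (single t c).coeff a ≠ 0 → a ≤ u := fun a ha =>
    (eq_of_coeff_single_ne_zero ha).trans_lt htu |>.le
  -- The new residual has only monomials smaller than `b`.
  have hnew : ∀ w, (g - (σ + single t c) ^ 2).coeff w ≠ 0 → w < b := by
    intro w hw
    refine lt_of_le_of_ne ?_ ?_
    · have h : g - (σ + single t c) ^ 2 = (g - σ ^ 2) - ((σ + single t c) ^ 2 - σ ^ 2) := by abel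
      rw [h] at hw
      rcases coeff_sub_ne_zero hw with hw | hw
      · exact hbmax w hw
      · obtain ⟨d, hd, hwd⟩ := exists_le_of_coeff_sq_sub hle hδu hw
        rwa [eq_of_coeff_single_ne_zero hd, ht] at hwd
    · rintro rfl
      have h : g - (σ + single t c) ^ 2 = (g - σ ^ 2) - c • (monomial K u * single t 1 +
          single t 1 * monomial K u) - ((σ - monomial K u) * single t c +
          single t c * (σ - monomial K u) + single t c * single t c) := by
        have h' : c • (monomial K u * single t 1 + single t 1 * monomial K u) =
            monomial K u * single t c + single t c * monomial K u := by
          rw [hsingle, mul_smul_comm, smul_mul_assoc, smul_add]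
        rw [h']
        noncomm_ring
      rw [h] at hw
      have hlt : ∀ a, (σ - monomial K u).coeff a ≠ 0 → a < u := by
        intro a ha
        refine lt_of_le_of_ne ?_ ?_
        · rcases coeff_sub_ne_zero ha with ha | ha
          · exact hle a ha
          · exact (eq_of_coeff_monomial_ne_zero ha).le
        · rintro rfl
          exact ha (by rw [coeff_sub, h1, coeff_monomial_self, sub_self])
      rcases coeff_sub_ne_zero hw with hw | hw
      · exact hw (by rw [coeff_sub, coeff_smul, he, hc, sub_self])
      · have h1 := le_max_left (u * t) (t * u)
        have h2 := le_max_right (u * t) (t * u)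
        rw [ht] at h1 h2
        rcases coeff_add_ne_zero hw with hw | hw
        · rcases coeff_add_ne_zero hw with hw | hw
          · obtain ⟨a, d, ha, hd, hw⟩ := exists_of_coeff_mul_ne_zero hw
            rw [eq_of_coeff_single_ne_zero hd] at hw
            exact absurd h1 (not_le_of_gt (hw ▸ mul_lt_mul_left (hlt a ha) t))
          · obtain ⟨d, a, hd, ha, hw⟩ := exists_of_coeff_mul_ne_zero hw
            rw [eq_of_coeff_single_ne_zero hd] at hw
            exact absurd h2 (not_le_of_gt (hw ▸ mul_lt_mul_right (hlt a ha) t))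
        · obtain ⟨a, d, ha, hd, hw⟩ := exists_of_coeff_mul_ne_zero hw
          rw [eq_of_coeff_single_ne_zero hd, eq_of_coeff_single_ne_zero ha] at hw
          exact absurd h1 (not_le_of_gt (hw ▸ mul_lt_mul_left htu t))
  have hcoeff : ∀ a, a ≠ t → (σ + single t c).coeff a = σ.coeff a := fun a ha => by
    rw [coeff_add, coeff_single_of_ne c ha, add_zero]
  have hcoeff_t : (σ + single t c).coeff t = c := by
    rw [coeff_add, hσt, coeff_single_self, zero_add]
  refine ⟨σ + single t c, ⟨?_, ?_, ?_⟩, ⟨?_, ?_⟩, ?_⟩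
  · rw [hcoeff u htu.ne', h1]
  · intro a ha
    rcases coeff_add_ne_zero ha with ha | ha
    · exact hle a ha
    · exact hδu a ha
  · intro a w ha hw
    rcases coeff_add_ne_zero ha with ha | ha
    · exact (hnew w hw).trans (hres a b ha hb)
    · rw [eq_of_coeff_single_ne_zero ha, ht]
      exact hnew w hw
  · intro a ha
    exact hcoeff a (htσ a ha).ne'
  · intro a w ha hw hw'
    rcases coeff_add_ne_zero hw' with h | h
    · exact absurd hw h
    · rw [eq_of_coeff_single_ne_zero h]
      exact htσ a ha
  · intro h
    exact hc0 (by rw [← hcoeff_t, h, hσt])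

/-- A series whose leading term is `u ^ 2` is a square. Transfinitely many terms are found one
after the other, in decreasing order; the order type of the process is hidden in Zorn's lemma. -/
theorem exists_sq_eq (h2 : (2 : K) ≠ 0) {g : MalcevNeumann K G} {u : G}
    (hg : g.coeff (u * u) = 1) (hle : ∀ a, g.coeff a ≠ 0 → a ≤ u * u) :
    ∃ ρ : MalcevNeumann K G, ρ ^ 2 = g := by
  have hstart : IsPartialSqrt g u (monomial K u) := by
    refine ⟨coeff_monomial_self u, fun a ha => (eq_of_coeff_monomial_ne_zero ha).le, ?_⟩
    intro a b ha hb
    rw [eq_of_coeff_monomial_ne_zero ha, max_self]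
    rw [sq, ← map_mul] at hb
    refine lt_of_le_of_ne ?_ ?_
    · rcases coeff_sub_ne_zero hb with hb | hb
      · exact hle b hb
      · exact (eq_of_coeff_monomial_ne_zero hb).le
    · rintro rfl
      exact hb (by rw [coeff_sub, hg, coeff_monomial_self, sub_self])
  have : Nonempty {σ : MalcevNeumann K G // IsPartialSqrt g u σ} := ⟨⟨_, hstart⟩⟩
  have hub : ∀ c : Set {σ : MalcevNeumann K G // IsPartialSqrt g u σ},
      IsChain (fun σ τ => IsEndExtension σ.1 τ.1) c → c.Nonempty →
      ∃ τ : {σ : MalcevNeumann K G // IsPartialSqrt g u σ}, ∀ σ ∈ c, IsEndExtension σ.1 τ.1 := by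
    intro c hc ⟨σ₀, hσ₀⟩
    obtain ⟨τ, hτ, hsupp⟩ := exists_union_of_chain (c := Subtype.val '' c) (by
      rintro _ ⟨σ, hσ, rfl⟩ _ ⟨τ, hτ, rfl⟩ hne
      exact hc hσ hτ (fun h => hne (congrArg _ h)))
    have hsupp' : ∀ a, τ.coeff a ≠ 0 → ∃ σ ∈ c, σ.1.coeff a ≠ 0 := by
      intro a ha
      obtain ⟨_, ⟨σ, hσ, rfl⟩, h⟩ := hsupp a ha
      exact ⟨σ, hσ, h⟩
    have hle' : ∀ a, τ.coeff a ≠ 0 → a ≤ u := by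
      intro a ha
      obtain ⟨σ, -, h⟩ := hsupp' a ha
      exact σ.2.2.1 a h
    refine ⟨⟨τ, ?_, hle', ?_⟩, fun σ hσ => hτ _ ⟨σ, hσ, rfl⟩⟩
    · rw [(hτ _ ⟨σ₀, hσ₀, rfl⟩).1 u (by rw [σ₀.2.1]; exact one_ne_zero), σ₀.2.1]
    · intro a b ha hb
      obtain ⟨σ, hσ, hσa⟩ := hsupp' a ha
      have hστ := hτ _ ⟨σ, hσ, rfl⟩
      have hδ : ∀ d, (τ - σ.1).coeff d ≠ 0 → τ.coeff d ≠ 0 ∧ d < a := by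
        intro d hd
        by_cases h : σ.1.coeff d = 0
        · have h' : τ.coeff d ≠ 0 := by rwa [coeff_sub, h, sub_zero] at hd
          exact ⟨h', hστ.2 a d hσa h h'⟩
        · exact absurd (by rw [coeff_sub, hστ.1 d h, sub_self]) hd
      have h : g - τ ^ 2 = (g - σ.1 ^ 2) - ((σ.1 + (τ - σ.1)) ^ 2 - σ.1 ^ 2) := by
        rw [add_sub_cancel]
        abel
      rw [h] at hb
      rcases coeff_sub_ne_zero hb with hb | hb
      · exact σ.2.2.2 a b hσa hb
      · obtain ⟨d, hd, hbd⟩ := exists_le_of_coeff_sq_sub σ.2.2.1 (fun d hd => hle' d (hδ d hd).1) hb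
        exact lt_max_mul_mul (hδ d hd).2 hbd
  obtain ⟨m, hm⟩ := exists_maximal_of_nonempty_chains_bounded hub (fun h h' => h.trans h')
  by_contra! hne
  obtain ⟨τ, hτ, hext, hτm⟩ := m.2.exists_extension h2 (hne m.1)
  exact hτm ((hm ⟨τ, hτ⟩ hext).antisymm hext)

end MalcevNeumann

/-! ### Words -/

/-- The positive words, as elements of the free group. -/
def FreeMonoid.toFreeGroup (X : Type*) : FreeMonoid X →* FreeGroup X :=
  FreeMonoid.lift FreeGroup.of

namespace FreeMonoid

variable {X : Type*}

theorem toWord_toFreeGroup [DecidableEq X] (w : FreeMonoid X) :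
    (toFreeGroup X w).toWord = w.toList.map fun i => (i, true) := by
  have h : toFreeGroup X w = FreeGroup.mk (w.toList.map fun i => (i, true)) := by
    induction w using FreeMonoid.inductionOn' with
    | one => rfl
    | of_mul i w ih =>
      rw [map_mul, ih, toFreeGroup, FreeMonoid.lift_eval_of, FreeGroup.of, FreeGroup.mul_mk]
      rfl
  rw [h, FreeGroup.toWord_mk]
  apply FreeGroup.IsReduced.reduce_eq
  rw [FreeGroup.IsReduced, List.isChain_map]
  exact (List.pairwise_of_forall fun _ _ _ => rfl).isChain

theorem toFreeGroup_injective : Injective (toFreeGroup X) := by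
  classical
  intro v w h
  have h' := congrArg FreeGroup.toWord h
  rw [toWord_toFreeGroup, toWord_toFreeGroup] at h'
  exact FreeMonoid.toList.injective
    (List.map_injective_iff.2 (fun i j hij => congrArg Prod.fst hij) h')

theorem not_hasNegativePower_toFreeGroup [DecidableEq X] (w : FreeMonoid X) :
    ¬ HasNegativePower (toFreeGroup X w) := by
  rintro ⟨i, hi⟩
  rw [toWord_toFreeGroup] at hi
  simp at hi

end FreeMonoid

section TotalDegree

variable {X : Type*}

theorem totalDegree_mul (a b : FreeGroup X) :
    totalDegree (a * b) = totalDegree a + totalDegree b := by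
  simp [totalDegree]

theorem totalDegree_pow (a : FreeGroup X) (n : ℕ) : totalDegree (a ^ n) = n * totalDegree a := by
  simp [totalDegree]

theorem totalDegree_of (i : X) : totalDegree (FreeGroup.of i) = 1 := by
  simp [totalDegree]

end TotalDegree

namespace FreeAlgebra

variable {K X : Type*} [Field K]

variable (K) in
/-- The words, as monomials of the free algebra. -/
def word : FreeMonoid X →* FreeAlgebra K X := FreeMonoid.lift (ι K)

theorem word_of (i : X) : word K (FreeMonoid.of i) = ι K i := FreeMonoid.lift_eval_of _ _

theorem equivMonoidAlgebraFreeMonoid_symm_single (w : FreeMonoid X) (c : K) :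
    equivMonoidAlgebraFreeMonoid.symm (MonoidAlgebra.single w c) = c • word K w := by
  simp [equivMonoidAlgebraFreeMonoid, word]

theorem wordCoeff_add (p q : FreeAlgebra K X) : (p + q).wordCoeff = p.wordCoeff + q.wordCoeff := by
  simp [wordCoeff]

theorem wordCoeff_smul (c : K) (p : FreeAlgebra K X) : (c • p).wordCoeff = c • p.wordCoeff := by
  simp [wordCoeff]

theorem wordCoeff_word (w : FreeMonoid X) : (word K w).wordCoeff = Finsupp.single w 1 := by
  have h := equivMonoidAlgebraFreeMonoid_symm_single w (1 : K)
  rw [one_smul, AlgEquiv.symm_apply_eq] at h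
  rw [wordCoeff, ← h, MonoidAlgebra.coeff_single]

theorem wordCoeff_injective : Injective (wordCoeff : FreeAlgebra K X → _) := fun _ _ h =>
  equivMonoidAlgebraFreeMonoid.injective (MonoidAlgebra.coeff_injective h)

/-- A property of noncommutative polynomials that holds for monomials and is stable under linear
combinations holds for all of them. -/
theorem word_induction {P : FreeAlgebra K X → Prop} (p : FreeAlgebra K X) (zero : P 0)
    (add : ∀ p q, P p → P q → P (p + q)) (smul : ∀ (c : K) w, P (c • word K w)) : P p := by
  obtain ⟨q, rfl⟩ := (equivMonoidAlgebraFreeMonoid (R := K) (X := X)).symm.surjective p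
  induction q using MonoidAlgebra.induction_linear with
  | zero => rwa [map_zero]
  | add q r hq hr =>
    rw [map_add]
    exact add _ _ hq hr
  | single w c =>
    rw [equivMonoidAlgebraFreeMonoid_symm_single]
    exact smul c w

theorem eq_sum_word (p : FreeAlgebra K X) :
    p = p.wordCoeff.sum fun w c => c • word K w := by
  induction p using word_induction with
  | zero => simp [wordCoeff]
  | add p q hp hq =>
    rw [wordCoeff_add, Finsupp.sum_add_index' (by simp) (by simp [add_smul]), ← hp, ← hq]
  | smul c w =>
    rw [wordCoeff_smul, wordCoeff_word, Finsupp.smul_single, Finsupp.sum_single_index (by simp)]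
    simp

theorem leadingComponent_word_add {a : FreeMonoid X} {q : FreeAlgebra K X}
    (hq : ∀ w, q.wordCoeff w ≠ 0 → w.length < a.length) :
    (word K a + q).leadingComponent = word K a := by
  classical
  have hqa : q.wordCoeff a = 0 := by
    by_contra h
    exact lt_irrefl _ (hq a h)
  have hdeg : (word K a + q).deg = a.length := by
    apply le_antisymm
    · refine Finset.sup_le fun w hw => ?_
      by_contra! h
      rw [Finsupp.mem_support_iff, wordCoeff_add, wordCoeff_word, Finsupp.add_apply,
        Finsupp.single_apply, if_neg (by rintro rfl; exact lt_irrefl _ h), zero_add] at hw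
      exact lt_asymm h (hq w hw)
    · refine Finset.le_sup (f := FreeMonoid.length) (Finsupp.mem_support_iff.2 ?_)
      simp [wordCoeff_add, wordCoeff_word, hqa]
  apply wordCoeff_injective
  rw [wordCoeff_word, leadingComponent, wordCoeff, AlgEquiv.apply_symm_apply,
    MonoidAlgebra.coeff_ofCoeff, hdeg]
  ext w
  rw [Finsupp.filter_apply, wordCoeff_add, wordCoeff_word, Finsupp.add_apply]
  split_ifs with h
  · have : q.wordCoeff w = 0 := by
      by_contra h'
      exact (hq w h').ne h
    rw [this, add_zero]
  · rw [Finsupp.single_apply, if_neg (by rintro rfl; exact h rfl)]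

end FreeAlgebra

namespace MalcevNeumann

variable {K X : Type*} [Field K] [LinearOrder (FreeGroup X)] [MulLeftMono (FreeGroup X)]
  [MulRightMono (FreeGroup X)]

open FreeAlgebra

theorem ofFreeAlgebra_word (w : FreeMonoid X) :
    ofFreeAlgebra K X (word K w) = monomial K (FreeMonoid.toFreeGroup X w) := by
  have h : ((ofFreeAlgebra K X : FreeAlgebra K X →* MalcevNeumann K (FreeGroup X)).comp
      (word K)) = (monomial K).comp (FreeMonoid.toFreeGroup X) := by
    ext i : 2
    simp [word, ofFreeAlgebra, FreeMonoid.toFreeGroup, monomial]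
  exact DFunLike.congr_fun h w

theorem coeff_ofFreeAlgebra (p : FreeAlgebra K X) (w : FreeMonoid X) :
    (ofFreeAlgebra K X p).coeff (FreeMonoid.toFreeGroup X w) = p.wordCoeff w := by
  classical
  induction p using word_induction with
  | zero => simp [wordCoeff, coeff_zero]
  | add p q hp hq => rw [map_add, coeff_add, hp, hq, wordCoeff_add, Finsupp.add_apply]
  | smul c v =>
    rw [map_smul, coeff_smul, ofFreeAlgebra_word, wordCoeff_smul, wordCoeff_word,
      Finsupp.smul_apply, smul_eq_mul, Finsupp.single_apply]
    congr 1
    refine (coeff_single _ _ _).trans (if_congr ?_ rfl rfl)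
    rw [FreeMonoid.toFreeGroup_injective.eq_iff, eq_comm]

theorem exists_word_of_coeff_ofFreeAlgebra_ne_zero {p : FreeAlgebra K X} {a : FreeGroup X}
    (h : (ofFreeAlgebra K X p).coeff a ≠ 0) : ∃ w, FreeMonoid.toFreeGroup X w = a := by
  induction p using word_induction with
  | zero => exact absurd (by rw [map_zero, coeff_zero]) h
  | add p q hp hq =>
    rw [map_add] at h
    exact (coeff_add_ne_zero h).elim hp hq
  | smul c v =>
    rw [map_smul, coeff_smul, ofFreeAlgebra_word] at h
    exact ⟨v, (eq_of_coeff_monomial_ne_zero (right_ne_zero_of_mul h)).symm⟩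

end MalcevNeumann

/-! ### Centralizers of monomials -/

/-- A series commuting with a monomial `t` has only monomials that commute with `t`: its support
is stable under conjugation by `t` and has no infinite increasing sequence. -/
theorem MalcevNeumann.commute_of_commute_monomial {K G : Type*} [Field K] [Group G]
    [LinearOrder G] [MulLeftMono G] [MulRightMono G] {t : G} {σ : MalcevNeumann K G}
    (h : Commute σ (monomial K t)) {a : G} (ha : σ.coeff a ≠ 0) : Commute a t := by
  have hconj : ∀ b, σ.coeff (t * b * t⁻¹) = σ.coeff b := by
    intro b
    have := congrArg (fun τ => τ.coeff (t * b)) h.eq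
    simpa only [coeff_monomial_mul, coeff_mul_monomial, inv_mul_cancel_left] using this
  obtain ⟨b, ⟨hb, n, hn⟩, hmax⟩ := σ.support_wo
    {b | σ.coeff b ≠ 0 ∧ ∃ n : ℤ, b = t ^ n * a * (t ^ n)⁻¹} (fun b hb => hb.1)
    ⟨a, ha, 0, by simp⟩
  have h1 : t * b * t⁻¹ ≤ b := hmax ⟨by rwa [hconj], n + 1, by
    rw [hn, zpow_add, zpow_one, ← (Commute.self_zpow t n).eq]; group⟩
  have h2 : t⁻¹ * b * t ≤ b := hmax ⟨by
    rw [← hconj]; simpa [mul_assoc] using hb, n - 1, by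
    rw [hn, zpow_sub, zpow_one, ← ((Commute.refl t).inv_left.zpow_right n).eq]; group⟩
  have h3 : b ≤ t * b * t⁻¹ := by
    have := mul_le_mul_left (mul_le_mul_right h2 t) t⁻¹
    simpa [mul_assoc] using this
  have hbt : Commute b t := by
    have := mul_inv_eq_iff_eq_mul.1 (le_antisymm h1 h3)
    exact this.symm
  have hab : a = (t ^ n)⁻¹ * b * t ^ n := by rw [hn]; group
  have hbtn : b * t ^ n = t ^ n * b := (hbt.zpow_right n).eq
  rw [hab, mul_assoc, hbtn, inv_mul_cancel_left]
  exact hbt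

theorem commute_of_commute_sq {G : Type*} [Group G] [LinearOrder G] [MulLeftMono G]
    [MulRightMono G] {a t : G} (h : Commute a (t ^ 2)) : Commute a t := by
  have h' : a * t * t = t * t * a := by rw [mul_assoc, ← sq, h.eq]
  rcases lt_trichotomy (a * t) (t * a) with hlt | heq | hlt
  · have h1 := mul_lt_mul_left hlt t
    have h2 := mul_lt_mul_right hlt t
    rw [h', mul_assoc t a, mul_assoc t t] at h1
    exact absurd h1 (lt_asymm h2)
  · exact heq
  · have h1 := mul_lt_mul_left hlt t
    have h2 := mul_lt_mul_right hlt t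
    rw [h', mul_assoc t a, mul_assoc t t] at h1
    exact absurd h1 (lt_asymm h2)

namespace FreeMonoid

/-- The word `(x y) ^ k x`. -/
def palindrome (k : ℕ) : FreeMonoid (Fin 2) := (of 0 * of 1) ^ k * of 0

theorem length_palindrome (k : ℕ) : (palindrome k).length = 2 * k + 1 := by
  induction k with
  | zero => rfl
  | succ k ih =>
    rw [palindrome, pow_succ', mul_assoc, length_mul, ← palindrome, ih]
    simp
    ring

/-- The word `(x y) ^ k x` is not a proper power: a word commuting with it is a power of it. In a
proper factorization of `(x y) ^ k x` into two commuting words both factors would begin and end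
with `x`, but the letters alternate. -/
theorem exists_eq_pow_of_commute (k : ℕ) {a : FreeMonoid (Fin 2)}
    (h : Commute a (palindrome k)) : ∃ j : ℕ, a = palindrome k ^ j := by
  set t : FreeMonoid (Fin 2) := palindrome k with ht
  have hL : t.toList.head? = some 0 ∧ t.toList.getLast? = some 0 ∧
      t.toList.IsChain (· ≠ ·) := by
    rw [ht, palindrome]
    clear h ht t a
    induction k with
    | zero => simp [FreeMonoid.toList_of]
    | succ k ih =>
      obtain ⟨h1, h2, h3⟩ := ih
      have hc : ((of 0 * of 1) ^ (k + 1) * of 0 : FreeMonoid (Fin 2)).toList =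
          0 :: 1 :: ((of 0 * of 1) ^ k * of 0 : FreeMonoid (Fin 2)).toList := by
        rw [pow_succ', mul_assoc, FreeMonoid.toList_mul]
        rfl
      rw [hc]
      generalize ((of 0 * of 1) ^ k * of 0 : FreeMonoid (Fin 2)).toList = l at *
      cases l with
      | nil => simp at h1
      | cons i l =>
        simp only [List.head?_cons, Option.some.injEq] at h1
        subst h1
        refine ⟨rfl, ?_, ?_⟩
        · simpa [List.getLast?_cons] using h2
        · simp [h3]
  generalize t = t at h hL
  obtain ⟨hhead, hlast, hchain⟩ := hL
  induction hn : a.length using Nat.strong_induction_on generalizing a with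
  | _ n ih =>
  have hcomm : a.toList ++ t.toList = t.toList ++ a.toList := h.eq
  rcases List.append_eq_append_iff.1 hcomm with ⟨c, h1, h2⟩ | ⟨c, h1, h2⟩
  · by_cases ha : a.toList = []
    · exact ⟨0, ha⟩
    by_cases hc : c = []
    · subst hc
      exact ⟨1, by rw [pow_one]; simpa using h2.symm⟩
    exfalso
    have hla : a.toList.getLast? = some 0 := by
      rw [← hlast, h2, List.getLast?_append_of_ne_nil _ ha]
    have hhc : c.head? = some 0 := by
      rw [← hhead, h2, List.head?_append_of_ne_nil _ hc]
    rw [h1, List.isChain_append] at hchain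
    exact hchain.2.2 0 hla 0 hhc rfl
  · have ht : t.toList ≠ [] := by
      intro h0
      simp [h0] at hhead
    have hc : Commute (FreeMonoid.ofList c) t := FreeMonoid.toList.injective (h2.symm.trans h1)
    have hlen : a.length = t.length + (FreeMonoid.ofList c).length := by
      have := congrArg List.length h1
      rwa [List.length_append] at this
    have htl : 0 < t.length := List.length_pos_iff.2 ht
    obtain ⟨j, hj⟩ := ih _ (by omega) hc rfl
    exact ⟨j + 1, by rw [pow_succ', ← hj]; exact FreeMonoid.toList.injective h1⟩
end FreeMonoid

/-! ### Homogeneous components -/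

namespace FreeAlgebra

section Dilation

variable {K X : Type*} [Field K]

variable (K X) in
/-- The homomorphism multiplying each variable by a central indeterminate `T`. The coefficient
of `T ^ n` in the image of `p` is the homogeneous component of degree `n` of `p`. -/
def dilation : FreeAlgebra K X →ₐ[K] Polynomial (FreeAlgebra K X) :=
  lift K fun i => Polynomial.monomial 1 (ι K i)

/-- The homogeneous component of degree `n`. -/
def component (n : ℕ) (p : FreeAlgebra K X) : FreeAlgebra K X := (dilation K X p).coeff n

theorem dilation_word (w : FreeMonoid X) :
    dilation K X (word K w) = Polynomial.monomial w.length (word K w) := by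
  induction w using FreeMonoid.inductionOn' with
  | one =>
    rw [map_one, map_one]
    rfl
  | of_mul i w ih =>
    rw [map_mul, map_mul, ih, word_of, dilation, lift_ι_apply, Polynomial.monomial_mul_monomial,
      FreeMonoid.length_mul, FreeMonoid.length_of]

theorem component_add (n : ℕ) (p q : FreeAlgebra K X) :
    component n (p + q) = component n p + component n q := by simp [component]

theorem component_sub (n : ℕ) (p q : FreeAlgebra K X) :
    component n (p - q) = component n p - component n q := by simp [component]

theorem component_smul (n : ℕ) (c : K) (p : FreeAlgebra K X) :
    component n (c • p) = c • component n p := by simp [component]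

theorem wordCoeff_component (n : ℕ) (p : FreeAlgebra K X) (w : FreeMonoid X) :
    (component n p).wordCoeff w = if w.length = n then p.wordCoeff w else 0 := by
  classical
  induction p using word_induction with
  | zero => simp [component, wordCoeff]
  | add p q hp hq =>
    rw [component_add, wordCoeff_add, wordCoeff_add, Finsupp.add_apply, Finsupp.add_apply, hp, hq]
    split_ifs <;> simp
  | smul c v =>
    rw [component_smul, component, dilation_word, Polynomial.coeff_monomial, wordCoeff_smul,
      wordCoeff_smul, Finsupp.smul_apply, Finsupp.smul_apply]
    by_cases hvw : v = w
    · subst hvw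
      split_ifs <;> simp [wordCoeff]
    · have h0 : (word K v).wordCoeff w = 0 := by
        rw [wordCoeff_word, Finsupp.single_apply, if_neg hvw]
      split_ifs <;> simp [h0] <;> simp [wordCoeff]

theorem length_eq_of_wordCoeff_component_ne_zero {n : ℕ} {p : FreeAlgebra K X} {w : FreeMonoid X}
    (h : (component n p).wordCoeff w ≠ 0) : w.length = n := by
  by_contra h'
  exact h (by rw [wordCoeff_component, if_neg h'])

theorem eq_zero_of_component_eq_zero {p : FreeAlgebra K X} (h : ∀ n, component n p = 0) :
    p = 0 := by
  apply wordCoeff_injective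
  ext w
  have := wordCoeff_component w.length p w
  rw [if_pos rfl, h] at this
  rw [← this]

end Dilation

/-! ### The centralizer of `u ^ 2 + x y + y x` -/

section Centralizer

variable {K : Type*} [Field K] (k : ℕ)

open FreeMonoid (palindrome)

/-- If `r` commutes with `u ^ 2`, where `u = (x y) ^ k x`, then all its monomials are powers
of `u`. -/
theorem exists_eq_pow_of_commute_sq [LinearOrder (FreeGroup (Fin 2))]
    [MulLeftMono (FreeGroup (Fin 2))] [MulRightMono (FreeGroup (Fin 2))]
    {r : FreeAlgebra K (Fin 2)} (h : Commute r (word K (palindrome k) ^ 2))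
    {a : FreeMonoid (Fin 2)} (ha : r.wordCoeff a ≠ 0) : ∃ j : ℕ, a = palindrome k ^ j := by
  have h1 := h.map (MalcevNeumann.ofFreeAlgebra K (Fin 2))
  rw [← map_pow, MalcevNeumann.ofFreeAlgebra_word] at h1
  rw [← MalcevNeumann.coeff_ofFreeAlgebra] at ha
  have h2 := MalcevNeumann.commute_of_commute_monomial h1 ha
  rw [map_pow] at h2
  have h3 := commute_of_commute_sq h2
  refine FreeMonoid.exists_eq_pow_of_commute k (FreeMonoid.toFreeGroup_injective ?_)
  rw [map_mul, map_mul, h3.eq]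

theorem commute_word_of_commute_sq [LinearOrder (FreeGroup (Fin 2))]
    [MulLeftMono (FreeGroup (Fin 2))] [MulRightMono (FreeGroup (Fin 2))]
    {r : FreeAlgebra K (Fin 2)} (h : Commute r (word K (palindrome k) ^ 2)) :
    Commute r (word K (palindrome k)) := by
  rw [eq_sum_word r]
  refine Commute.sum_left _ _ _ fun a ha => ?_
  obtain ⟨j, hj⟩ := exists_eq_pow_of_commute_sq k h (Finsupp.mem_support_iff.1 ha)
  refine Commute.smul_left ?_ (r.wordCoeff a)
  rw [hj, map_pow]
  exact (Commute.refl _).pow_left j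

/-- The homogeneous elements commuting with `u ^ 2` are the multiples of the powers of `u`. -/
theorem component_eq_smul_of_commute_sq [LinearOrder (FreeGroup (Fin 2))]
    [MulLeftMono (FreeGroup (Fin 2))] [MulRightMono (FreeGroup (Fin 2))]
    {p : FreeAlgebra K (Fin 2)} {n : ℕ}
    (h : Commute (component n p) (word K (palindrome k) ^ 2)) (h0 : component n p ≠ 0) :
    ∃ (c : K) (j : ℕ), c ≠ 0 ∧ n = j * (2 * k + 1) ∧
      component n p = c • word K (palindrome k) ^ j := by
  classical
  have hlen : ∀ j : ℕ, (palindrome k ^ j).length = j * (2 * k + 1) := by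
    intro j
    induction j with
    | zero => simp
    | succ j ih => rw [pow_succ, FreeMonoid.length_mul, ih, FreeMonoid.length_palindrome]; ring
  obtain ⟨a, ha⟩ : ∃ a, (component n p).wordCoeff a ≠ 0 := by
    by_contra! h'
    refine h0 (wordCoeff_injective ?_)
    ext a
    rw [h' a]
    simp [wordCoeff]
  obtain ⟨j, rfl⟩ := exists_eq_pow_of_commute_sq k h ha
  have hn := length_eq_of_wordCoeff_component_ne_zero ha
  rw [hlen] at hn
  refine ⟨_, j, ha, hn.symm, ?_⟩
  apply wordCoeff_injective
  ext b
  rw [wordCoeff_smul, ← map_pow, wordCoeff_word, Finsupp.smul_apply, Finsupp.single_apply]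
  split_ifs with hb
  · rw [← hb, smul_eq_mul, mul_one]
  · rw [smul_zero]
    by_contra hb'
    obtain ⟨i, rfl⟩ := exists_eq_pow_of_commute_sq k h hb'
    have hi := length_eq_of_wordCoeff_component_ne_zero hb'
    rw [hlen, ← hn] at hi
    exact hb (by rw [Nat.eq_of_mul_eq_mul_right (by omega) hi])

variable (K) in
/-- The polynomial `x y + y x`. -/
def xyAddYx : FreeAlgebra K (Fin 2) :=
  word K (FreeMonoid.of 0 * FreeMonoid.of 1) + word K (FreeMonoid.of 1 * FreeMonoid.of 0)

variable (K) in
/-- The polynomial `u ^ 2 + x y + y x` with `u = (x y) ^ k x`. -/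
def squareAddXyAddYx : FreeAlgebra K (Fin 2) := word K (palindrome k) ^ 2 + xyAddYx K

variable {k}

theorem dilation_squareAddXyAddYx : dilation K (Fin 2) (squareAddXyAddYx K k) =
    Polynomial.monomial (4 * k + 2) (word K (palindrome k) ^ 2) +
      Polynomial.monomial 2 (xyAddYx K) := by
  rw [squareAddXyAddYx, xyAddYx, map_add, map_add, map_pow, dilation_word, dilation_word,
    dilation_word, Polynomial.monomial_pow, FreeMonoid.length_palindrome, FreeMonoid.length_mul,
    FreeMonoid.length_mul, map_add, show (2 * k + 1) * 2 = 4 * k + 2 by ring]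
  rfl

theorem component_mul_squareAddXyAddYx (p : FreeAlgebra K (Fin 2)) (n : ℕ) :
    component (n + (4 * k + 2)) (p * squareAddXyAddYx K k) =
      component n p * word K (palindrome k) ^ 2 + component (n + 4 * k) p * xyAddYx K := by
  rw [component, map_mul, dilation_squareAddXyAddYx, mul_add, Polynomial.coeff_add,
    Polynomial.coeff_mul_monomial, show n + (4 * k + 2) = (n + 4 * k) + 2 by ring,
    Polynomial.coeff_mul_monomial, component, component]

theorem component_squareAddXyAddYx_mul (p : FreeAlgebra K (Fin 2)) (n : ℕ) :
    component (n + (4 * k + 2)) (squareAddXyAddYx K k * p) =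
      word K (palindrome k) ^ 2 * component n p + xyAddYx K * component (n + 4 * k) p := by
  rw [component, map_mul, dilation_squareAddXyAddYx, add_mul, Polynomial.coeff_add,
    Polynomial.coeff_monomial_mul, show n + (4 * k + 2) = (n + 4 * k) + 2 by ring,
    Polynomial.coeff_monomial_mul, component, component]

/-- The homogeneous parts of the relation `p g = g p`. -/
theorem component_commutator {p : FreeAlgebra K (Fin 2)} (h : Commute p (squareAddXyAddYx K k))
    (n : ℕ) :
    component n p * word K (palindrome k) ^ 2 + component (n + 4 * k) p * xyAddYx K =
      word K (palindrome k) ^ 2 * component n p + xyAddYx K * component (n + 4 * k) p := by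
  rw [← component_mul_squareAddXyAddYx, ← component_squareAddXyAddYx_mul, h.eq]

/-- `p` has no components of degree above `N`, and that of degree `N` is `a`. -/
def HasTop (p : FreeAlgebra K (Fin 2)) (N : ℕ) (a : FreeAlgebra K (Fin 2)) : Prop :=
  component N p = a ∧ ∀ n, N < n → component n p = 0

theorem HasTop.mul (hk : 0 < k) {p a : FreeAlgebra K (Fin 2)} {N : ℕ} (h : HasTop p N a) :
    HasTop (p * squareAddXyAddYx K k) (N + (4 * k + 2)) (a * word K (palindrome k) ^ 2) := by
  refine ⟨?_, fun n hn => ?_⟩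
  · rw [component_mul_squareAddXyAddYx, h.1, h.2 _ (by omega), zero_mul, add_zero]
  · obtain ⟨m, rfl⟩ : ∃ m, n = m + (4 * k + 2) := ⟨n - (4 * k + 2), by omega⟩
    rw [component_mul_squareAddXyAddYx, h.2 _ (by omega), h.2 _ (by omega), zero_mul, zero_mul,
      add_zero]

theorem hasTop_pow (hk : 0 < k) (i : ℕ) : HasTop (squareAddXyAddYx K k ^ i)
    (i * (4 * k + 2)) (word K (palindrome k) ^ (2 * i)) := by
  induction i with
  | zero =>
    refine ⟨?_, fun n hn => ?_⟩
    · simp [component]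
    · simp only [zero_mul] at hn
      rw [pow_zero, component, map_one, Polynomial.coeff_one, if_neg hn.ne']
  | succ i ih =>
    have := ih.mul hk
    rwa [← pow_succ, ← pow_add, show i * (4 * k + 2) + (4 * k + 2) = (i + 1) * (4 * k + 2) by ring,
      show 2 * i + 2 = 2 * (i + 1) by ring] at this

/-- With `u = word (palindrome k)`, a solution `q` of
`q u ^ 2 - u ^ 2 q = (v + w) u ^ (2 m + 3) - u ^ (2 m + 3) (v + w)`. It is the second highest
component of `ρ ^ (2 m + 3)`, where `ρ ^ 2 = g`. -/
def secondComponent {R : Type*} [Ring R] (u v w : R) : ℕ → R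
  | 0 => (v + w) * u + u * v
  | m + 1 => u ^ 2 * secondComponent u v w m + (v + w) * u ^ (2 * m + 3)

theorem secondComponent_commutator {R : Type*} [Ring R] {u v w : R} (h : v * u = u * w) (m : ℕ) :
    secondComponent u v w m * u ^ 2 - u ^ 2 * secondComponent u v w m =
      (v + w) * u ^ (2 * m + 3) - u ^ (2 * m + 3) * (v + w) := by
  induction m with
  | zero =>
    rw [secondComponent, ← sub_eq_zero, mul_zero, zero_add]
    have h' : ((v + w) * u + u * v) * u ^ 2 - u ^ 2 * ((v + w) * u + u * v) -
        ((v + w) * u ^ 3 - u ^ 3 * (v + w)) =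
        u * (v * u - u * w) * u - u ^ 2 * (v * u - u * w) := by noncomm_ring
    rw [h', h, sub_self, mul_zero, zero_mul, mul_zero, sub_zero]
  | succ m ih =>
    rw [secondComponent]
    calc _ = u ^ 2 * (secondComponent u v w m * u ^ 2 - u ^ 2 * secondComponent u v w m) +
          ((v + w) * (u ^ (2 * m + 3) * u ^ 2) - u ^ 2 * (v + w) * u ^ (2 * m + 3)) := by
          noncomm_ring
      _ = (v + w) * (u ^ (2 * m + 3) * u ^ 2) - (u ^ 2 * u ^ (2 * m + 3)) * (v + w) := by
          rw [ih]
          noncomm_ring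
      _ = _ := by
          rw [← pow_add, ← pow_add, show 2 * m + 3 + 2 = 2 * (m + 1) + 3 by ring,
            show 2 + (2 * m + 3) = 2 * (m + 1) + 3 by ring]

/-- The image of `u` under `matrixRep`. -/
def signMatrix (K : Type*) [Field K] : Matrix (Fin 2) (Fin 2) K := !![1, 0; 0, -1]

/-- The image of `x y` under `matrixRep`. -/
def reflectionMatrix (K : Type*) [Field K] : Matrix (Fin 2) (Fin 2) K := !![1, 1; 0, -1]

theorem signMatrix_mul_self : signMatrix K * signMatrix K = 1 := by
  simp [signMatrix, Matrix.one_fin_two]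

theorem reflectionMatrix_mul_self : reflectionMatrix K * reflectionMatrix K = 1 := by
  simp [reflectionMatrix, Matrix.one_fin_two]

variable (K k) in
/-- The representation by `2 × 2` matrices for which the images of `u = (x y) ^ k x` and `x y` are
`signMatrix` and `reflectionMatrix`. The image of `u ^ 2` is `1`, and that of `x y + y x` is twice
that of `u`. -/
def matrixRep : FreeAlgebra K (Fin 2) →ₐ[K] Matrix (Fin 2) (Fin 2) K :=
  lift K ![reflectionMatrix K ^ k * signMatrix K, signMatrix K * reflectionMatrix K ^ (k + 1)]

theorem matrixRep_xy :
    matrixRep K k (word K (FreeMonoid.of 0 * FreeMonoid.of 1)) = reflectionMatrix K := by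
  simp only [matrixRep, map_mul, word_of, lift_ι_apply, Matrix.cons_val_zero, Matrix.cons_val_one]
  rw [mul_assoc, ← mul_assoc (signMatrix K), signMatrix_mul_self, one_mul, pow_succ, ← mul_assoc,
    ← (Commute.refl (reflectionMatrix K)).mul_pow, reflectionMatrix_mul_self, one_pow, one_mul]

theorem matrixRep_yx : matrixRep K k (word K (FreeMonoid.of 1 * FreeMonoid.of 0)) =
    signMatrix K * reflectionMatrix K * signMatrix K := by
  simp only [matrixRep, map_mul, word_of, lift_ι_apply, Matrix.cons_val_zero, Matrix.cons_val_one]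
  rw [mul_assoc, ← mul_assoc (_ ^ (k + 1)), pow_succ', mul_assoc (reflectionMatrix K),
    ← (Commute.refl (reflectionMatrix K)).mul_pow, reflectionMatrix_mul_self, one_pow, mul_one,
    mul_assoc]

theorem matrixRep_palindrome : matrixRep K k (word K (palindrome k)) = signMatrix K := by
  rw [palindrome, map_mul, map_pow, map_mul, map_pow, matrixRep_xy, matrixRep, word_of,
    lift_ι_apply, Matrix.cons_val_zero, ← mul_assoc,
    ← (Commute.refl (reflectionMatrix K)).mul_pow, reflectionMatrix_mul_self, one_pow, one_mul]

theorem matrixRep_xyAddYx : matrixRep K k (xyAddYx K) = (2 : K) • signMatrix K := by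
  rw [xyAddYx, map_add, matrixRep_xy, matrixRep_yx]
  simp [signMatrix, reflectionMatrix]
  norm_num

theorem matrixRep_secondComponent (m : ℕ) : ∃ c : K, matrixRep K k (secondComponent
    (word K (palindrome k)) (word K (FreeMonoid.of 0 * FreeMonoid.of 1))
    (word K (FreeMonoid.of 1 * FreeMonoid.of 0)) m) =
      c • 1 + signMatrix K * reflectionMatrix K := by
  have hpow : ∀ i : ℕ, signMatrix K ^ (2 * i + 1) = signMatrix K := by
    intro i
    rw [pow_succ, pow_mul, sq, signMatrix_mul_self, one_pow, one_mul]
  induction m with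
  | zero =>
    refine ⟨2, ?_⟩
    rw [secondComponent, ← xyAddYx, map_add, map_mul, map_mul, matrixRep_xyAddYx,
      matrixRep_palindrome, matrixRep_xy, smul_mul_assoc, signMatrix_mul_self]
  | succ m ih =>
    obtain ⟨c, hc⟩ := ih
    have hstep : ∀ q, matrixRep K k (word K (palindrome k) ^ 2 * q +
        xyAddYx K * word K (palindrome k) ^ (2 * m + 3)) =
        matrixRep K k q + (2 : K) • 1 := by
      intro q
      rw [map_add, map_mul, map_mul, map_pow, map_pow, matrixRep_xyAddYx, matrixRep_palindrome, sq,
        signMatrix_mul_self, one_mul, show 2 * m + 3 = 2 * (m + 1) + 1 by ring, hpow,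
        smul_mul_assoc, signMatrix_mul_self]
    refine ⟨c + 2, ?_⟩
    rw [secondComponent, ← xyAddYx, hstep, hc, add_smul]
    abel

theorem word_xy_mul_word_palindrome :
    word K (FreeMonoid.of 0 * FreeMonoid.of 1) * word K (palindrome k) =
      word K (palindrome k) * word K (FreeMonoid.of 1 * FreeMonoid.of 0) := by
  rw [← map_mul, ← map_mul, palindrome, ← mul_assoc, ← pow_succ', pow_succ]
  simp only [mul_assoc]

/-- In degrees from `4 k` on, the components of an element commuting with `g` commute with `u` under
`matrixRep`: as the image of `u ^ 2` is `1`, the relation `p g = g p` says that each of them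
commutes with the image of `x y + y x`, which is twice that of `u`. -/
theorem commute_matrixRep_component (h2 : (2 : K) ≠ 0) {p : FreeAlgebra K (Fin 2)}
    (h : Commute p (squareAddXyAddYx K k)) {n : ℕ} (hn : 4 * k ≤ n) :
    Commute (matrixRep K k (component n p)) (signMatrix K) := by
  obtain ⟨m, rfl⟩ := Nat.exists_eq_add_of_le' hn
  have h1 := congrArg (matrixRep K k) (component_commutator h m)
  simp only [map_add, map_mul, matrixRep_palindrome, matrixRep_xyAddYx, sq,
    signMatrix_mul_self, mul_one, one_mul, add_right_inj, mul_smul_comm, smul_mul_assoc] at h1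
  exact smul_right_injective _ h2 h1

/-- An element commuting with `g` does not have an odd power of `u` as its top component: the
component `4 k` degrees lower would have to be `secondComponent` up to an element commuting with
`u`, but `secondComponent` does not commute with `u` under `matrixRep`. -/
theorem eq_zero_of_hasTop_odd [LinearOrder (FreeGroup (Fin 2))] [MulLeftMono (FreeGroup (Fin 2))]
    [MulRightMono (FreeGroup (Fin 2))] (h2 : (2 : K) ≠ 0) (hk : 0 < k)
    {p : FreeAlgebra K (Fin 2)} (h : Commute p (squareAddXyAddYx K k)) {c : K} {i : ℕ}
    (htop : HasTop p ((2 * i + 1) * (2 * k + 1)) (c • word K (palindrome k) ^ (2 * i + 1))) :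
    c = 0 := by
  -- The factor `g ^ 2` brings all components involved into the range of `secondComponent` and of
  -- `commute_matrixRep_component`.
  obtain ⟨q, hq, htop⟩ : ∃ q, Commute q (squareAddXyAddYx K k) ∧
      HasTop q ((2 * i + 5) * (2 * k + 1)) (c • word K (palindrome k) ^ (2 * (i + 1) + 3)) := by
    refine ⟨p * squareAddXyAddYx K k * squareAddXyAddYx K k,
      (h.mul_left (.refl _)).mul_left (.refl _), ?_⟩
    have := (htop.mul hk).mul hk
    rwa [smul_mul_assoc, ← pow_add, smul_mul_assoc, ← pow_add,
      show (2 * i + 1) * (2 * k + 1) + (4 * k + 2) + (4 * k + 2) = (2 * i + 5) * (2 * k + 1) by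
        ring, show 2 * i + 1 + 2 + 2 = 2 * (i + 1) + 3 by ring] at this
  obtain ⟨n, hn⟩ : ∃ n, n + 4 * k = (2 * i + 5) * (2 * k + 1) ∧ 4 * k ≤ n :=
    ⟨(2 * i + 5) * (2 * k + 1) - 4 * k, by
      have : (2 * i + 5) * (2 * k + 1) = 4 * (i * k) + 10 * k + 2 * i + 5 := by ring
      omega⟩
  have h1 := component_commutator hq n
  rw [hn.1, htop.1, smul_mul_assoc, mul_smul_comm] at h1
  set s := secondComponent (word K (palindrome k)) (word K (FreeMonoid.of 0 * FreeMonoid.of 1))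
    (word K (FreeMonoid.of 1 * FreeMonoid.of 0)) (i + 1) with hs
  have h3 := secondComponent_commutator (word_xy_mul_word_palindrome (K := K) (k := k)) (i + 1)
  rw [← hs, ← xyAddYx] at h3
  have h4 : Commute (component n q - c • s) (word K (palindrome k) ^ 2) := by
    rw [commute_iff_eq, ← sub_eq_zero]
    calc _ = (component n q * word K (palindrome k) ^ 2 - word K (palindrome k) ^ 2 *
          component n q) - c • (s * word K (palindrome k) ^ 2 - word K (palindrome k) ^ 2 * s) := by
          simp only [sub_mul, mul_sub, smul_mul_assoc, mul_smul_comm, smul_sub]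
          abel
      _ = 0 := by
          rw [h3, smul_sub, sub_eq_zero, sub_eq_sub_iff_add_eq_add, h1, add_comm]
  have h5 := (commute_word_of_commute_sq k h4).map (matrixRep K k)
  rw [matrixRep_palindrome] at h5
  have h6 := (commute_matrixRep_component h2 hq hn.2).sub_left h5
  obtain ⟨e, he⟩ := matrixRep_secondComponent (K := K) (k := k) (i + 1)
  rw [← map_sub, sub_sub_cancel, map_smul, hs, he] at h6
  have h7 := congrFun (congrFun h6.eq 0) 1
  simp [signMatrix, reflectionMatrix, Matrix.one_fin_two] at h7
  have h8 : 2 * c = 0 := by linear_combination -h7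
  exact (mul_eq_zero.1 h8).resolve_left h2

theorem mem_adjoin_of_commute [LinearOrder (FreeGroup (Fin 2))] [MulLeftMono (FreeGroup (Fin 2))]
    [MulRightMono (FreeGroup (Fin 2))] (h2 : (2 : K) ≠ 0) (hk : 0 < k) (N : ℕ)
    {p : FreeAlgebra K (Fin 2)} (h : Commute p (squareAddXyAddYx K k))
    (hN : ∀ n, N ≤ n → component n p = 0) : p ∈ Algebra.adjoin K {squareAddXyAddYx K k} := by
  induction N generalizing p with
  | zero =>
    rw [eq_zero_of_component_eq_zero fun n => hN n n.zero_le]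
    exact zero_mem _
  | succ N ih =>
    by_cases h0 : component N p = 0
    · refine ih h fun n hn => ?_
      rcases hn.eq_or_lt with rfl | hn
      · exact h0
      · exact hN n hn
    have hcomm : Commute (component N p) (word K (palindrome k) ^ 2) := by
      have := component_commutator h N
      rwa [hN (N + 4 * k) (by omega), zero_mul, mul_zero, add_zero, add_zero] at this
    obtain ⟨c, j, hc, rfl, hcj⟩ := component_eq_smul_of_commute_sq k hcomm h0
    rcases Nat.even_or_odd' j with ⟨i, rfl | rfl⟩
    · have hg := hasTop_pow (K := K) hk i
      rw [show i * (4 * k + 2) = 2 * i * (2 * k + 1) by ring] at hg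
      have hmem : squareAddXyAddYx K k ^ i ∈ Algebra.adjoin K {squareAddXyAddYx K k} :=
        pow_mem (Algebra.subset_adjoin (Set.mem_singleton _)) i
      have h1 := ih (p := p - c • squareAddXyAddYx K k ^ i)
        (h.sub_left (((Commute.refl _).pow_left i).smul_left c)) (fun n hn => by
          rw [component_sub, component_smul]
          rcases hn.eq_or_lt with rfl | hn
          · rw [hg.1, hcj, sub_self]
          · rw [hg.2 n hn, hN n hn, smul_zero, sub_zero])
      have := add_mem h1 (Subalgebra.smul_mem _ hmem c)
      rwa [sub_add_cancel] at this
    · exact absurd (eq_zero_of_hasTop_odd h2 hk h ⟨hcj, fun n hn => hN n hn⟩) hc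

theorem generatesCentralizer_squareAddXyAddYx [LinearOrder (FreeGroup (Fin 2))]
    [MulLeftMono (FreeGroup (Fin 2))] [MulRightMono (FreeGroup (Fin 2))] (h2 : (2 : K) ≠ 0)
    (hk : 0 < k) : (squareAddXyAddYx K k).GeneratesCentralizer := by
  apply le_antisymm
  · intro p hp
    have hp' : Commute p (squareAddXyAddYx K k) :=
      ((Subalgebra.mem_centralizer_iff K).1 hp _ (Set.mem_singleton _)).symm
    exact mem_adjoin_of_commute h2 hk ((dilation K (Fin 2) p).natDegree + 1) hp'
      fun n hn => Polynomial.coeff_eq_zero_of_natDegree_lt hn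
  · rw [Algebra.adjoin_le_iff, Set.singleton_subset_iff]
    exact (Subalgebra.mem_centralizer_iff K).2 fun g hg => by rw [Set.mem_singleton_iff.1 hg]

theorem isSquare_leadingComponent (hk : 0 < k) :
    IsSquare (squareAddXyAddYx K k).leadingComponent := by
  classical
  refine ⟨word K (palindrome k), ?_⟩
  rw [squareAddXyAddYx, ← map_pow, leadingComponent_word_add, sq, map_mul]
  intro w hw
  rw [sq, FreeMonoid.length_mul, FreeMonoid.length_palindrome]
  have h : w.length = 2 := by
    by_contra h
    refine hw ?_
    rw [xyAddYx, wordCoeff_add, wordCoeff_word, wordCoeff_word, Finsupp.add_apply,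
      Finsupp.single_apply, Finsupp.single_apply, if_neg, if_neg, add_zero]
    all_goals
      rintro rfl
      exact h rfl
  omega

end Centralizer

end FreeAlgebra

/-! ### The square root of `u ^ 2 + x y + y x` -/

namespace MalcevNeumann

variable {K X : Type*} [Field K] [LinearOrder (FreeGroup X)] [MulLeftMono (FreeGroup X)]
  [MulRightMono (FreeGroup X)]

theorem totalDegree_le_of_coeff_mul_ne_zero {σ τ : MalcevNeumann K (FreeGroup X)} {m n : ℤ}
    (hσ : ∀ a, σ.coeff a ≠ 0 → totalDegree a ≤ m) (hτ : ∀ a, τ.coeff a ≠ 0 → totalDegree a ≤ n)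
    {a : FreeGroup X} (h : (σ * τ).coeff a ≠ 0) : totalDegree a ≤ m + n := by
  obtain ⟨b, c, hb, hc, rfl⟩ := exists_of_coeff_mul_ne_zero h
  rw [totalDegree_mul]
  exact add_le_add (hσ b hb) (hτ c hc)

/-- The degree of `σ` can be read off from the leading monomial of `uσ + σu`. -/
theorem totalDegree_le_of_anticommutator (h2 : (2 : K) ≠ 0)
    (hdeg : ∀ a b : FreeGroup X, totalDegree a < totalDegree b → a < b) {u : FreeGroup X}
    {σ : MalcevNeumann K (FreeGroup X)} {n : ℤ}
    (h : ∀ b, σ.coeff b ≠ 0 → (∀ a, σ.coeff a ≠ 0 → a ≤ b) →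
      (monomial K u * σ + σ * monomial K u).coeff (max (u * b) (b * u)) ≠ 0 →
      totalDegree (max (u * b) (b * u)) ≤ n)
    {a : FreeGroup X} (ha : σ.coeff a ≠ 0) : totalDegree a ≤ n - totalDegree u := by
  obtain ⟨b, hb, hmax⟩ := exists_leading (σ := σ) (by rintro rfl; exact ha rfl)
  have h1 := h b hb hmax (coeff_anticommutator_ne_zero h2 u hb hmax)
  have h3 : totalDegree (max (u * b) (b * u)) = totalDegree u + totalDegree b := by
    rcases max_choice (u * b) (b * u) with h | h <;> rw [h, totalDegree_mul]
    exact add_comm _ _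
  have h4 : totalDegree a ≤ totalDegree b := by
    by_contra! h4
    exact absurd (hmax a ha) (not_le_of_gt (hdeg _ _ h4))
  omega

/-- Let `u = (x y) ^ k x`, `v = x y` and `w = y x`, and let `c = u⁻¹ v = w u⁻¹`. Then
`(u + c) ^ 2 = u ^ 2 + v + w + c ^ 2`, so that a square root of `u ^ 2 + v + w` with leading term
`u` starts with `u + c`, and its next term has degree at most `4 - 3 deg u`. This determines
its cube in positive degrees. -/
theorem coeff_cube_of_sq_eq (h2 : (2 : K) ≠ 0)
    (hdeg : ∀ a b : FreeGroup X, totalDegree a < totalDegree b → a < b)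
    {u v w : FreeGroup X} (huv : v * u = u * w) (hu : 5 ≤ totalDegree u)
    (hv : totalDegree v = 2) (hw : totalDegree w = 2)
    {ρ : MalcevNeumann K (FreeGroup X)}
    (hρ : ρ ^ 2 = monomial K u ^ 2 + (monomial K v + monomial K w))
    (hρu : ρ.coeff u = 1) (hle : ∀ a, ρ.coeff a ≠ 0 → a ≤ u) {a : FreeGroup X}
    (ha : 0 < totalDegree a) :
    (ρ ^ 3).coeff a = (monomial K u ^ 3 + (monomial K u * monomial K v +
      monomial K u * monomial K w + monomial K w * monomial K u)).coeff a := by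
  obtain ⟨c, hc⟩ : ∃ c, c = u⁻¹ * v := ⟨_, rfl⟩
  have huc : monomial K u * monomial K c = monomial K v := by
    rw [← map_mul, hc, mul_inv_cancel_left]
  have hcu : monomial K c * monomial K u = monomial K w := by
    rw [← map_mul, hc, mul_assoc, huv, inv_mul_cancel_left]
  have hvu : monomial K v * monomial K u = monomial K u * monomial K w := by
    rw [← map_mul, ← map_mul, huv]
  obtain ⟨δ, hδ⟩ : ∃ δ, δ = ρ - monomial K u := ⟨_, rfl⟩
  obtain ⟨ε, hε⟩ : ∃ ε, ε = δ - monomial K c := ⟨_, rfl⟩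
  have hδlt : ∀ b, δ.coeff b ≠ 0 → b < u := by
    intro b hb
    rw [hδ] at hb
    refine lt_of_le_of_ne ?_ ?_
    · rcases coeff_sub_ne_zero hb with hb | hb
      · exact hle b hb
      · exact (eq_of_coeff_monomial_ne_zero hb).le
    · rintro rfl
      exact hb (by rw [coeff_sub, hρu, coeff_monomial_self, sub_self])
  have hδeq : monomial K u * δ + δ * monomial K u = monomial K v + monomial K w - δ * δ := by
    have h : monomial K u * δ + δ * monomial K u = ρ ^ 2 - monomial K u ^ 2 - δ * δ := by
      rw [hδ]
      noncomm_ring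
    rw [h, hρ]
    abel
  have hεeq : monomial K u * ε + ε * monomial K u = -(δ * δ) := by
    have h : monomial K u * ε + ε * monomial K u = monomial K u * δ + δ * monomial K u -
        monomial K u * monomial K c - monomial K c * monomial K u := by
      rw [hε]
      noncomm_ring
    rw [h, hδeq, huc, hcu]
    abel
  have hVW : ∀ b, (monomial K v + monomial K w).coeff b ≠ 0 → totalDegree b ≤ 2 := by
    intro b hb
    rcases coeff_add_ne_zero hb with hb | hb
    · rw [eq_of_coeff_monomial_ne_zero hb, hv]
    · rw [eq_of_coeff_monomial_ne_zero hb, hw]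
  have hδdeg : ∀ b, δ.coeff b ≠ 0 → totalDegree b ≤ 2 - totalDegree u := by
    intro b hb
    refine totalDegree_le_of_anticommutator h2 hdeg (fun m _ hmax hne => ?_) hb
    rw [hδeq] at hne
    rcases coeff_sub_ne_zero hne with h | h
    · exact hVW _ h
    -- The monomials of `δ * δ` are smaller than the leading one of `uδ + δu`.
    · obtain ⟨a, d, ha, hd, had⟩ := exists_of_coeff_mul_ne_zero h
      have h1 : a * d < max (u * m) (m * u) := (mul_lt_mul_left (hδlt a ha) d).trans_le
        (le_max_of_le_left (mul_le_mul_right (hmax d hd) u))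
      exact absurd had h1.ne
  have hεdeg : ∀ b, ε.coeff b ≠ 0 → totalDegree b ≤
      (2 - totalDegree u) + (2 - totalDegree u) - totalDegree u := by
    intro b hb
    refine totalDegree_le_of_anticommutator h2 hdeg (fun m _ _ hm => ?_) hb
    rw [hεeq] at hm
    exact totalDegree_le_of_coeff_mul_ne_zero hδdeg hδdeg (coeff_neg_ne_zero hm)
  have hcube : ρ ^ 3 = monomial K u ^ 3 + (monomial K u * monomial K v +
      monomial K u * monomial K w + monomial K w * monomial K u) +
      ((monomial K v + monomial K w) * δ + monomial K u ^ 2 * ε) := by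
    have h : ρ = monomial K u + δ := by rw [hδ]; abel
    have h' : monomial K u ^ 2 * δ = monomial K u * monomial K v + monomial K u ^ 2 * ε := by
      rw [hε, mul_sub, ← huc]
      noncomm_ring
    calc ρ ^ 3 = ρ ^ 2 * ρ := pow_succ ρ 2
      _ = (monomial K u ^ 2 + (monomial K v + monomial K w)) * (monomial K u + δ) := by
        rw [hρ, ← h]
      _ = monomial K u ^ 3 + (monomial K v * monomial K u + monomial K w * monomial K u) +
          ((monomial K v + monomial K w) * δ + monomial K u ^ 2 * δ) := by noncomm_ring
      _ = _ := by
        rw [h', hvu]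
        abel
  rw [hcube, coeff_add _ ((monomial K v + monomial K w) * δ + monomial K u ^ 2 * ε), add_eq_left]
  by_contra h
  rcases coeff_add_ne_zero h with h | h
  · have := totalDegree_le_of_coeff_mul_ne_zero hVW hδdeg h
    omega
  · have hU : ∀ b, (monomial K u ^ 2).coeff b ≠ 0 → totalDegree b ≤ 2 * totalDegree u := by
      intro b hb
      rw [← map_pow] at hb
      rw [eq_of_coeff_monomial_ne_zero hb, totalDegree_pow]
      simp
    have := totalDegree_le_of_coeff_mul_ne_zero hU hεdeg h
    omega

/-- The leading term of a square root. -/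
theorem leading_of_sq_eq {G : Type*} [Group G] [LinearOrder G] [MulLeftMono G] [MulRightMono G]
    {g ρ : MalcevNeumann K G} {u : G} (hg : g.coeff (u * u) = 1)
    (hle : ∀ a, g.coeff a ≠ 0 → a ≤ u * u) (hρ : ρ ^ 2 = g) :
    (ρ.coeff u = 1 ∨ ρ.coeff u = -1) ∧ ∀ a, ρ.coeff a ≠ 0 → a ≤ u := by
  have hρ0 : ρ ≠ 0 := by
    rintro rfl
    rw [← hρ, sq, mul_zero, coeff_zero] at hg
    exact zero_ne_one hg
  obtain ⟨b, hb, hmax⟩ := exists_leading hρ0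
  have hbb : g.coeff (b * b) = ρ.coeff b * ρ.coeff b := by
    rw [← hρ, sq, coeff_mul_of_le hmax hmax]
  have h1 : b * b ≤ u * u := hle _ (by rw [hbb]; exact mul_ne_zero hb hb)
  have h2 : u * u ≤ b * b := by
    rw [← hρ, sq] at hg
    obtain ⟨a, d, ha, hd, had⟩ := exists_of_coeff_mul_ne_zero (w := u * u)
      (by rw [hg]; exact one_ne_zero)
    rw [← had]
    exact mul_le_mul' (hmax a ha) (hmax d hd)
  have hbu : b = u := by
    rcases lt_trichotomy b u with h | h | h
    · exact absurd h2 (not_le_of_gt (mul_lt_mul_of_lt_of_lt h h))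
    · exact h
    · exact absurd h1 (not_le_of_gt (mul_lt_mul_of_lt_of_lt h h))
  subst hbu
  exact ⟨mul_self_eq_one_iff.1 (hbb.symm.trans hg), hmax⟩

end MalcevNeumann

end

theorem theorem4p2 {K : Type*} [Field K] [CharZero K]
    [LinearOrder (FreeGroup (Fin 2))] [MulLeftMono (FreeGroup (Fin 2))]
    [MulRightMono (FreeGroup (Fin 2))]
    (hdeg : ∀ a b : FreeGroup (Fin 2), totalDegree a < totalDegree b → a < b)
    (k : ℕ) (hk : 2 ≤ k)
    (x y u v w f g : FreeAlgebra K (Fin 2))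
    (hx : x = FreeAlgebra.ι K 0) (hy : y = FreeAlgebra.ι K 1)
    (hu : u = (x * y) ^ k * x) (hv : v = x * y) (hw : w = y * x)
    (hf : f = u ^ 3 + (u * v + u * w + w * u))
    (hg : g = u ^ 2 + (v + w))
    (u₀ : FreeGroup (Fin 2))
    (hu₀ : u₀ = (FreeGroup.of 0 * FreeGroup.of 1) ^ k * FreeGroup.of 0) :
    g.GeneratesCentralizer ∧
    IsSquare g.leadingComponent ∧
    (∃ ρ : MalcevNeumann K (FreeGroup (Fin 2)),
      ρ ^ 2 = MalcevNeumann.ofFreeAlgebra K (Fin 2) g) ∧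
    (∀ ρ : MalcevNeumann K (FreeGroup (Fin 2)),
      ρ ^ 2 = MalcevNeumann.ofFreeAlgebra K (Fin 2) g →
      ((ρ.coeff u₀ = 1 ∧
          (ρ ^ 3).positivePart = MalcevNeumann.ofFreeAlgebra K (Fin 2) f) ∨
        (ρ.coeff u₀ = -1 ∧
          (ρ ^ 3).positivePart = -MalcevNeumann.ofFreeAlgebra K (Fin 2) f)) ∧
      ¬ (ρ ^ 3).HasPositiveMonomialWithNegativePower) ∧
    ¬ MakarLimanovYuConjecture K (Fin 2) := by
  have h2 : (2 : K) ≠ 0 := two_ne_zero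
  obtain ⟨v₀, hv₀⟩ : ∃ v₀ : FreeGroup (Fin 2), v₀ = FreeGroup.of 0 * FreeGroup.of 1 := ⟨_, rfl⟩
  obtain ⟨w₀, hw₀⟩ : ∃ w₀ : FreeGroup (Fin 2), w₀ = FreeGroup.of 1 * FreeGroup.of 0 := ⟨_, rfl⟩
  have hgdef : g = FreeAlgebra.squareAddXyAddYx K k := by
    rw [hg, hu, hv, hw, hx, hy, FreeAlgebra.squareAddXyAddYx, FreeAlgebra.xyAddYx,
      FreeMonoid.palindrome]
    simp only [map_mul, map_pow, FreeAlgebra.word_of]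
  have hx' : MalcevNeumann.ofFreeAlgebra K (Fin 2) x =
      MalcevNeumann.monomial K (FreeGroup.of 0) := by
    rw [hx]
    exact FreeAlgebra.lift_ι_apply _ _
  have hy' : MalcevNeumann.ofFreeAlgebra K (Fin 2) y =
      MalcevNeumann.monomial K (FreeGroup.of 1) := by
    rw [hy]
    exact FreeAlgebra.lift_ι_apply _ _
  have hu' : MalcevNeumann.ofFreeAlgebra K (Fin 2) u = MalcevNeumann.monomial K u₀ := by
    rw [hu, hu₀]
    simp only [map_mul, map_pow, hx', hy']
  have hv' : MalcevNeumann.ofFreeAlgebra K (Fin 2) v = MalcevNeumann.monomial K v₀ := by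
    rw [hv, hv₀, map_mul, map_mul, hx', hy']
  have hw' : MalcevNeumann.ofFreeAlgebra K (Fin 2) w = MalcevNeumann.monomial K w₀ := by
    rw [hw, hw₀, map_mul, map_mul, hx', hy']
  have hg' : MalcevNeumann.ofFreeAlgebra K (Fin 2) g = MalcevNeumann.monomial K u₀ ^ 2 +
      (MalcevNeumann.monomial K v₀ + MalcevNeumann.monomial K w₀) := by
    rw [hg, map_add, map_add, map_pow, hu', hv', hw']
  have hf' : MalcevNeumann.ofFreeAlgebra K (Fin 2) f = MalcevNeumann.monomial K u₀ ^ 3 +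
      (MalcevNeumann.monomial K u₀ * MalcevNeumann.monomial K v₀ +
        MalcevNeumann.monomial K u₀ * MalcevNeumann.monomial K w₀ +
        MalcevNeumann.monomial K w₀ * MalcevNeumann.monomial K u₀) := by
    rw [hf]
    simp only [map_add, map_mul, map_pow, hu', hv', hw']
  have hdu : totalDegree u₀ = 2 * k + 1 := by
    rw [hu₀]
    simp only [totalDegree_mul, totalDegree_pow, totalDegree_of]
    ring
  have hdv : totalDegree v₀ = 2 := by
    rw [hv₀, totalDegree_mul, totalDegree_of, totalDegree_of]
    rfl
  have hdw : totalDegree w₀ = 2 := by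
    rw [hw₀, totalDegree_mul, totalDegree_of, totalDegree_of]
    rfl
  have hvu : v₀ * u₀ = u₀ * w₀ := by
    rw [hv₀, hu₀, hw₀, ← mul_assoc, ← pow_succ', pow_succ]
    simp only [mul_assoc]
  have hlt : ∀ a, (MalcevNeumann.monomial K v₀ + MalcevNeumann.monomial K w₀).coeff a ≠ 0 →
      a < u₀ * u₀ := by
    intro a ha
    apply hdeg
    rw [totalDegree_mul, hdu]
    rcases MalcevNeumann.coeff_add_ne_zero ha with ha | ha
    · rw [MalcevNeumann.eq_of_coeff_monomial_ne_zero ha, hdv]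
      omega
    · rw [MalcevNeumann.eq_of_coeff_monomial_ne_zero ha, hdw]
      omega
  have hgle : ∀ a, (MalcevNeumann.ofFreeAlgebra K (Fin 2) g).coeff a ≠ 0 → a ≤ u₀ * u₀ := by
    intro a ha
    rw [hg'] at ha
    rcases MalcevNeumann.coeff_add_ne_zero ha with ha | ha
    · rw [← map_pow] at ha
      rw [MalcevNeumann.eq_of_coeff_monomial_ne_zero ha, sq]
    · exact (hlt a ha).le
  have hglead : (MalcevNeumann.ofFreeAlgebra K (Fin 2) g).coeff (u₀ * u₀) = 1 := by
    have h0 : (MalcevNeumann.monomial K v₀ + MalcevNeumann.monomial K w₀).coeff (u₀ * u₀) = 0 := by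
      by_contra h
      exact lt_irrefl _ (hlt _ h)
    rw [hg', MalcevNeumann.coeff_add, h0, add_zero, sq, ← map_mul,
      MalcevNeumann.coeff_monomial_self]
  have hfpos : ∀ a, (MalcevNeumann.ofFreeAlgebra K (Fin 2) f).coeff a ≠ 0 →
      0 < totalDegree a := by
    intro a ha
    simp only [hf', ← map_mul, ← map_pow] at ha
    have hd : totalDegree a = 3 * (2 * k + 1) ∨ totalDegree a = 2 * k + 3 := by
      rcases MalcevNeumann.coeff_add_ne_zero ha with ha | ha
      · rw [MalcevNeumann.eq_of_coeff_monomial_ne_zero ha, totalDegree_pow, hdu]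
        exact Or.inl rfl
      · right
        rcases MalcevNeumann.coeff_add_ne_zero ha with ha | ha
        · rcases MalcevNeumann.coeff_add_ne_zero ha with ha | ha
          · rw [MalcevNeumann.eq_of_coeff_monomial_ne_zero ha, totalDegree_mul, hdu, hdv]
            ring
          · rw [MalcevNeumann.eq_of_coeff_monomial_ne_zero ha, totalDegree_mul, hdu, hdw]
            ring
        · rw [MalcevNeumann.eq_of_coeff_monomial_ne_zero ha, totalDegree_mul, hdu, hdw]
          ring
    omega
  have hpos : ∀ ρ : MalcevNeumann K (FreeGroup (Fin 2)),
      ρ ^ 2 = MalcevNeumann.ofFreeAlgebra K (Fin 2) g → ρ.coeff u₀ = 1 →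
      (ρ ^ 3).positivePart = MalcevNeumann.ofFreeAlgebra K (Fin 2) f := by
    intro ρ hρ h1
    ext a
    change (if 0 < totalDegree a then (ρ ^ 3).coeff a else 0) = _
    split_ifs with ha
    · rw [hf']
      exact MalcevNeumann.coeff_cube_of_sq_eq h2 hdeg hvu (by omega) hdv hdw (hρ.trans hg') h1
        (MalcevNeumann.leading_of_sq_eq hglead hgle hρ).2 ha
    · by_contra h
      exact ha (hfpos a (Ne.symm h))
  have hroot : ∀ ρ : MalcevNeumann K (FreeGroup (Fin 2)),
      ρ ^ 2 = MalcevNeumann.ofFreeAlgebra K (Fin 2) g →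
      ((ρ.coeff u₀ = 1 ∧
          (ρ ^ 3).positivePart = MalcevNeumann.ofFreeAlgebra K (Fin 2) f) ∨
        (ρ.coeff u₀ = -1 ∧
          (ρ ^ 3).positivePart = -MalcevNeumann.ofFreeAlgebra K (Fin 2) f)) := by
    intro ρ hρ
    rcases (MalcevNeumann.leading_of_sq_eq hglead hgle hρ).1 with h1 | h1
    · exact Or.inl ⟨h1, hpos ρ hρ h1⟩
    · refine Or.inr ⟨h1, ?_⟩
      rw [← hpos (-ρ) (by rw [neg_sq, hρ]) (by rw [MalcevNeumann.coeff_neg, h1, neg_neg]),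
        Odd.neg_pow (by decide)]
      ext a
      rw [MalcevNeumann.coeff_neg]
      simp only [MalcevNeumann.positivePart, MalcevNeumann.coeff_neg]
      split_ifs <;> simp
  have hnot : ∀ ρ : MalcevNeumann K (FreeGroup (Fin 2)),
      ρ ^ 2 = MalcevNeumann.ofFreeAlgebra K (Fin 2) g →
      ¬ (ρ ^ 3).HasPositiveMonomialWithNegativePower := by
    rintro ρ hρ ⟨a, ha, hda, hneg⟩
    have h : (ρ ^ 3).positivePart.coeff a ≠ 0 := by
      change (if 0 < totalDegree a then (ρ ^ 3).coeff a else 0) ≠ 0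
      rwa [if_pos hda]
    have h' : (MalcevNeumann.ofFreeAlgebra K (Fin 2) f).coeff a ≠ 0 := by
      rcases hroot ρ hρ with ⟨-, hp⟩ | ⟨-, hp⟩
      · rwa [hp] at h
      · rw [hp] at h
        exact MalcevNeumann.coeff_neg_ne_zero h
    obtain ⟨b, rfl⟩ := MalcevNeumann.exists_word_of_coeff_ofFreeAlgebra_ne_zero h'
    exact FreeMonoid.not_hasNegativePower_toFreeGroup b hneg
  have hcent : g.GeneratesCentralizer := by
    rw [hgdef]
    exact FreeAlgebra.generatesCentralizer_squareAddXyAddYx h2 (by omega)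
  have hsq : IsSquare g.leadingComponent := by
    rw [hgdef]
    exact FreeAlgebra.isSquare_leadingComponent (by omega)
  have hex : ∃ ρ : MalcevNeumann K (FreeGroup (Fin 2)),
      ρ ^ 2 = MalcevNeumann.ofFreeAlgebra K (Fin 2) g :=
    MalcevNeumann.exists_sq_eq h2 hglead hgle
  refine ⟨hcent, hsq, hex, fun ρ hρ => ⟨hroot ρ hρ, hnot ρ hρ⟩, fun hconj => ?_⟩
  obtain ⟨ρ, hρ⟩ := hex
  obtain ⟨h, hh⟩ := hsq
  exact hnot ρ hρ (hconj g 2 two_pos hcent ⟨h, by rw [hh, sq]⟩ 3 (by norm_num) (by norm_num) ρ hρ)
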